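/- Let $p=(p_{kl})_{k,l\in\{0,1\}}$ be a probability vector with all $p_{kl}>0$. Let $X_i=\{0,1\}\times\{0,1\}$ ($i\in\mathbb N$) with the measure $\nu_i(\{(k,l)\})=p_{kl}$, and $(X,\mu)=\prod_i(X_i,\nu_i)$; write $x=(x_i)$, $x_i=(x_i^{(0)},x_i^{(1)})$. Let $\mathfrak S_\infty$ be the group of finite permutations of $\mathbb N$ and $G=(\mathbb Z_2)^{\infty}_e\rtimes\mathfrak S_\infty$ the wreath product, where $(\mathbb Z_2)^\infty_e$ is the group of finitely supported sequences and $s\gamma s^{-1}=(\gamma_{s^{-1}(i)})_i$. Let $\pi_\mu$ be the unitary representation of $G\times G$ in $L^2(X,\mu)$ given by $$(\pi_\mu(s_0,s_1)\zeta)(x)=\Big(\tfrac{d\mu(\mathfrak a x)}{d\mu(x)}\Big)^{1/2}\zeta(\mathfrak a x),\quad (\mathfrak a x)_i^{(k)}=x_{s_k(i)}^{(k)},\qquad (\pi_\mu(\gamma^{(0)},\gamma^{(1)})\zeta)(x)=(-1)^{\sum_{i,k}\gamma_i^{(k)}x_i^{(k)}}\zeta(x),$$ and put $\pi_\mu^{(0)}(g)=\pi_\mu(g,e)$,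 $\pi_\mu^{(1)}(g)=\pi_\mu(e,g)$. Let $m=(\sqrt{p_{kl}})\in M_2(\mathbb C)$ and let $\mathfrak H$ be the infinite tensor product Hilbert space $\bigotimes_i (M_2(\mathbb C),\operatorname{Tr}(b^*a),m)$, that is, the completion of the span of the tensors $a_1\otimes a_2\otimes\cdots$ with $a_i=m$ for all but finitely many $i$. Let $\mathfrak J:L^2(X,\mu)\to\mathfrak H$ be the unitary operator with $\mathfrak J\big(\prod_{i\le n}f_i(x_i)\big)=\mathfrak J_1f_1\otimes\cdots\otimes\mathfrak J_nf_n\otimes m\otimes m\otimes\cdots$, where $\mathfrak J_if=(f(k,l)\sqrt{p_{kl}})_{k,l}$. Let $\mathcal L(\mathfrak H)$ and $\mathcal R(\mathfrak H)$ be the $W^*$-algebras on $\mathfrak H$ generated by the left, respectively right, multiplications by the elements $a_1\otimes\cdots\otimes a_n\otimes I_2\otimes I_2\otimes\cdots$. The representation $\pi_\mu$, the unitary $\mathfrak J$ and these bounded multiplication operators exist, and $$\pi_\mu^{(0)}(G)''=\mathfrak J^{-1}\mathcal L(\mathfrak H)\mathfrak J,\qquad \pi_\mu^{(1)}(G)''=\mathfrak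 J^{-1}\mathcal R(\mathfrak H)\mathfrak J .$$ Suppose moreover that $\det[p_{kl}]\neq0$. Then $\xi=m\otimes m\otimes\cdots$ is cyclic and separating for $\mathcal L(\mathfrak H)$; the antilinear operators $a\xi\mapsto a^*\xi$ ($a\in\mathcal L(\mathfrak H)$) and $a'\xi\mapsto a'^*\xi$ ($a'\in\mathcal R(\mathfrak H)$) have closures $S$ and $F$, and $F=S^*$. The Okounkov operators $\mathcal O_j=\lim_{n\to\infty}\frac1n\sum_{l=1}^n\pi_\mu^{(0)}((j,l))$ exist in the strong operator topology and are boundedly invertible, and the modular operator $\Delta_\xi=FS$ is given by conjugation with them: for every $n$ and every left multiplication $a$ by an element $a_1\otimes\cdots\otimes a_n\otimes I_2\otimes I_2\otimes\cdots$, $$\Delta_\xi(a\xi)=P_n\,a\,P_n^{-1}\,\xi,\qquad P_n=\prod_{j=1}^n\mathfrak J\,\mathcal O_j\,\mathfrak J^{-1},$$ and the linear span of these vectors $a\xi$ is a core for $\Delta_\xi$. -/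

import Mathlib

open MeasureTheory Filter Topology

noncomputable section

/-! ### The wreath product `ℤ/2 ≀ 𝔖_∞` -/

/-- The group `𝔖_∞` of finite permutations of `ℕ`. -/
def FinPerm : Subgroup (Equiv.Perm ℕ) where
  carrier := {s | {i | s i ≠ i}.Finite}
  one_mem' := by simp
  mul_mem' := by
    intro s t hs ht
    refine (hs.union ht).subset fun i hi => ?_
    by_cases h : t i = i
    · left
      simpa [h] using hi
    · right
      exact h
  inv_mem' := by
    intro s hs
    refine hs.subset fun i hi h => hi ?_
    rw [Equiv.Perm.inv_eq_iff_eq]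
    exact h.symm

/-- The transposition `(k, l)` (the identity if `k = l`). -/
def transp (k l : ℕ) : FinPerm :=
  ⟨Equiv.swap k l, by
    refine (Set.toFinite {k, l}).subset fun i hi => ?_
    by_contra h
    simp only [Set.mem_insert_iff, Set.mem_singleton_iff, not_or] at h
    exact hi (Equiv.swap_apply_of_ne_of_ne h.1 h.2)⟩

/-- The group `(ℤ/2)^∞_e` of finitely supported sequences (additive notation inside
`Multiplicative`). -/
abbrev GammaInf : Type := Multiplicative (ℕ →₀ ZMod 2)

/-- The permutation action `(s • γ)_i = γ_{s⁻¹(i)}`. -/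
def permAction : FinPerm →* MulAut GammaInf where
  toFun s := AddEquiv.toMultiplicative (Finsupp.domCongr (s : Equiv.Perm ℕ))
  map_one' := by
    ext γ
    rfl
  map_mul' s t := by
    ext γ
    rfl

/-- The wreath product `G = (ℤ/2)^∞_e ⋊ 𝔖_∞`. -/
abbrev Wreath : Type := GammaInf ⋊[permAction] FinPerm

/-- The embedding `𝔖_∞ → G`. -/
def permG (s : FinPerm) : Wreath := SemidirectProduct.inr s

/-- The embedding `(ℤ/2)^∞_e → G`. -/
def gammaG (γ : ℕ →₀ ZMod 2) : Wreath := SemidirectProduct.inl (Multiplicative.ofAdd γ)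

/-! ### The measure space `(X, μ)` and the representation `π_μ` of `G × G` -/

/-- One factor `X_i = {0,1} × {0,1}`. -/
abbrev Site : Type := Fin 2 × Fin 2

/-- The product measure `μ` on `X = ∏ X_i`, every factor carrying the probability `p`. -/
def prodMeasure (p : PMF Site) : Measure (ℕ → Site) := Measure.infinitePi fun _ => p.toMeasure

instance (p : PMF Site) : IsProbabilityMeasure (prodMeasure p) := by
  unfold prodMeasure
  infer_instance

/-- The Hilbert space `L²(X, μ)`. -/
abbrev L2X (p : PMF Site) : Type := Lp ℂ 2 (prodMeasure p)

/-- The map `𝔞_{(s₀,s₁)} : X → X`, `(𝔞 x)_i^{(k)} = x_{s_k(i)}^{(k)}`. -/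
def actX (s₀ s₁ : FinPerm) (x : ℕ → Site) : ℕ → Site :=
  fun i => ((x (s₀.1 i)).1, (x (s₁.1 i)).2)

/-- The Radon-Nikodym derivative `dμ(𝔞_g x) / dμ(x)`: the density of the measure
`A ↦ μ(𝔞_g A)`, which is the image of `μ` under `𝔞_{g⁻¹} = 𝔞_g⁻¹`. -/
def rnX (p : PMF Site) (s₀ s₁ : FinPerm) (x : ℕ → Site) : ℝ :=
  (((prodMeasure p).map (actX s₀⁻¹ s₁⁻¹)).rnDeriv (prodMeasure p) x).toReal

/-- The exponent `∑_i γ_i^{(0)} x_i^{(0)} + ∑_i γ_i^{(1)} x_i^{(1)}`. -/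
def signExp (γ₀ γ₁ : ℕ →₀ ZMod 2) (x : ℕ → Site) : ℕ :=
  ∑ i ∈ γ₀.support, (γ₀ i).val * ((x i).1 : ℕ) + ∑ i ∈ γ₁.support, (γ₁ i).val * ((x i).2 : ℕ)

/-- `π` is the representation `π_μ` of `G × G` in `L²(X, μ)`. -/
structure IsRepMu (p : PMF Site)
    (π : Wreath × Wreath →* unitary (L2X p →L[ℂ] L2X p)) : Prop where
  perm : ∀ (s₀ s₁ : FinPerm) (ζ : L2X p),
    ((π (permG s₀, permG s₁) : L2X p →L[ℂ] L2X p) ζ : (ℕ → Site) → ℂ) =ᵐ[prodMeasure p]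
      fun x => (Real.sqrt (rnX p s₀ s₁ x) : ℂ) * ζ (actX s₀ s₁ x)
  gamma : ∀ (γ₀ γ₁ : ℕ →₀ ZMod 2) (ζ : L2X p),
    ((π (gammaG γ₀, gammaG γ₁) : L2X p →L[ℂ] L2X p) ζ : (ℕ → Site) → ℂ) =ᵐ[prodMeasure p]
      fun x => (-1 : ℂ) ^ signExp γ₀ γ₁ x * ζ x

/-- The operators `π_μ^{(0)}(G)`. -/
def rep0 {p : PMF Site} (π : Wreath × Wreath →* unitary (L2X p →L[ℂ] L2X p)) :
    Set (L2X p →L[ℂ] L2X p) :=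
  Set.range fun g : Wreath => (π (g, 1) : L2X p →L[ℂ] L2X p)

/-- The operators `π_μ^{(1)}(G)`. -/
def rep1 {p : PMF Site} (π : Wreath × Wreath →* unitary (L2X p →L[ℂ] L2X p)) :
    Set (L2X p →L[ℂ] L2X p) :=
  Set.range fun g : Wreath => (π (1, g) : L2X p →L[ℂ] L2X p)

/-- `O` is the Okounkov operator `𝒪_k^{(0)}`, the strong limit of
`n⁻¹ ∑_{l < n} π_μ^{(0)}((k, l))`. -/
def IsOkounkov {p : PMF Site} (π : Wreath × Wreath →* unitary (L2X p →L[ℂ] L2X p)) (k : ℕ)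
    (O : L2X p →L[ℂ] L2X p) : Prop :=
  ∀ ζ : L2X p, Tendsto
    (fun n : ℕ => (n : ℂ)⁻¹ • ∑ l ∈ Finset.range n,
      (π (permG (transp k l), 1) : L2X p →L[ℂ] L2X p) ζ) atTop (𝓝 (O ζ))

/-! ### The infinite tensor product of the pairs `(M₂(ℂ), 𝔍_i(𝕀))` -/

/-- The algebra `M₂(ℂ)`. -/
abbrev M2 : Type := Matrix (Fin 2) (Fin 2) ℂ

/-- The identification `𝔍_i : L²(X_i, ν_i) → M₂(ℂ)` which sends the orthonormal basis
`χ_{kl} / √p_{kl}` to the matrix units; so `f` goes to the matrix `(f(k,l) √p_{kl})`. -/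
def siteMatrix (p : PMF Site) (f : Site → ℂ) : M2 :=
  Matrix.of fun k l => f (k, l) * (Real.sqrt (p (k, l)).toReal : ℂ)

/-- The reference vector `𝔍_i(𝕀) = (√p_{kl})`. -/
def refMatrix (p : PMF Site) : M2 := siteMatrix p 1

/-- Elementary tensors `a₀ ⊗ a₁ ⊗ ⋯` with `a_i = 𝔍_i(𝕀)` for all but finitely many `i`. -/
structure ElemTensor (p : PMF Site) where
  /-- the sequence of factors -/
  toFun : ℕ → M2
  eventually_ref : ∀ᶠ i in atTop, toFun i = refMatrix p

/-- The inner product `∏_i Tr(a_i^* b_i)` of two elementary tensors, linear in `b`. -/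
def elemInner {p : PMF Site} (a b : ElemTensor p) : ℂ :=
  ∏ᶠ i, ((a.toFun i).conjTranspose * b.toFun i).trace

lemma trace_refMatrix (p : PMF Site) :
    ((refMatrix p).conjTranspose * refMatrix p).trace = 1 := by
  have h : ∑ z, (p z).toReal = 1 := by
    rw [← ENNReal.toReal_sum fun z _ => p.apply_ne_top z, ← tsum_fintype (L := .unconditional _),
      p.tsum_coe, ENNReal.toReal_one]
  have hs : ∀ z, (Real.sqrt (p z).toReal : ℂ) * (Real.sqrt (p z).toReal : ℂ)
      = ((p z).toReal : ℂ) := by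
    intro z
    rw [← Complex.ofReal_mul, Real.mul_self_sqrt ENNReal.toReal_nonneg]
  simp only [Matrix.trace, Matrix.diag, Matrix.mul_apply, Matrix.conjTranspose_apply, refMatrix,
    siteMatrix, Matrix.of_apply, Pi.one_apply, one_mul, RCLike.star_def, Complex.conj_ofReal, hs]
  rw [Finset.sum_comm, ← Fintype.sum_prod_type' fun k l => ((p (k, l)).toReal : ℂ)]
  exact_mod_cast h

lemma elemInner_eq_prod {p : PMF Site} (a b : ElemTensor p) (N : ℕ)
    (ha : ∀ i, N ≤ i → a.toFun i = refMatrix p) (hb : ∀ i, N ≤ i → b.toFun i = refMatrix p) :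
    elemInner a b
      = ∏ i ∈ Finset.range N, ((a.toFun i).conjTranspose * b.toFun i).trace := by
  refine finprod_eq_prod_of_mulSupport_subset _ fun i hi => ?_
  by_contra h
  simp only [Finset.coe_range, Set.mem_Iio, not_lt] at h
  exact hi (by simp only [ha i h, hb i h, trace_refMatrix])

lemma elemInner_conj {p : PMF Site} (a b : ElemTensor p) :
    (starRingEnd ℂ) (elemInner b a) = elemInner a b := by
  obtain ⟨N, hN⟩ := eventually_atTop.1 (a.eventually_ref.and b.eventually_ref)
  rw [elemInner_eq_prod b a N (fun i hi => (hN i hi).2) (fun i hi => (hN i hi).1),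
    elemInner_eq_prod a b N (fun i hi => (hN i hi).1) (fun i hi => (hN i hi).2), map_prod]
  refine Finset.prod_congr rfl fun i _ => ?_
  rw [starRingEnd_apply, ← Matrix.trace_conjTranspose, Matrix.conjTranspose_mul,
    Matrix.conjTranspose_conjTranspose]

/-- Formal linear combinations of elementary tensors. -/
def PreTensor (p : PMF Site) : Type := ElemTensor p →₀ ℂ

instance (p : PMF Site) : AddCommGroup (PreTensor p) :=
  inferInstanceAs (AddCommGroup (ElemTensor p →₀ ℂ))

instance (p : PMF Site) : Module ℂ (PreTensor p) :=
  inferInstanceAs (Module ℂ (ElemTensor p →₀ ℂ))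

/-- The sesquilinear extension of `elemInner`. -/
def preInner {p : PMF Site} (x y : ElemTensor p →₀ ℂ) : ℂ :=
  x.sum fun a c => y.sum fun b d => (starRingEnd ℂ) c * d * elemInner a b

lemma preInner_self {p : PMF Site} (x : ElemTensor p →₀ ℂ) : 0 ≤ (preInner x x).re := by
  have hN : ∃ N, ∀ a ∈ x.support, ∀ i, N ≤ i → a.toFun i = refMatrix p := by
    have h : ∀ᶠ i in atTop, ∀ a ∈ x.support, a.toFun i = refMatrix p :=
      (Filter.eventually_all_finset x.support).2 fun a _ => a.eventually_ref
    obtain ⟨N, hN⟩ := eventually_atTop.1 h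
    exact ⟨N, fun a ha i hi => hN i hi a ha⟩
  obtain ⟨N, hN⟩ := hN
  let φ : ElemTensor p → (Fin N → Site) → ℂ := fun a K =>
    ∏ i : Fin N, a.toFun i (K i).1 (K i).2
  have key : ∀ a ∈ x.support, ∀ b ∈ x.support,
      elemInner a b = ∑ K, (starRingEnd ℂ) (φ a K) * φ b K := by
    intro a ha b hb
    rw [elemInner_eq_prod a b N (hN a ha) (hN b hb), Finset.prod_range]
    have : ∀ i : Fin N, ((a.toFun i).conjTranspose * b.toFun i).trace
        = ∑ z : Site, (starRingEnd ℂ) (a.toFun i z.1 z.2) * b.toFun i z.1 z.2 := by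
      intro i
      rw [Fintype.sum_prod_type, Finset.sum_comm]
      rfl
    simp only [this, φ, map_prod, ← Finset.prod_mul_distrib]
    exact Finset.prod_univ_sum (fun _ => Finset.univ)
      (fun (i : Fin N) (z : Site) =>
        (starRingEnd ℂ) (a.toFun i z.1 z.2) * b.toFun i z.1 z.2) |>.trans (by simp)
  have : preInner x x
      = ∑ K, (starRingEnd ℂ) (∑ a ∈ x.support, x a * φ a K) * ∑ a ∈ x.support, x a * φ a K := by
    simp only [preInner, Finsupp.sum, map_sum, map_mul, Finset.sum_mul_sum]
    rw [Finset.sum_comm (s := Finset.univ)]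
    refine Finset.sum_congr rfl fun a ha => ?_
    rw [Finset.sum_comm (s := Finset.univ)]
    refine Finset.sum_congr rfl fun b hb => ?_
    rw [key a ha b hb, Finset.mul_sum]
    refine Finset.sum_congr rfl fun K _ => ?_
    ring
  rw [this, Complex.re_sum]
  refine Finset.sum_nonneg fun K _ => ?_
  rw [mul_comm, Complex.mul_conj, Complex.ofReal_re]
  exact Complex.normSq_nonneg _

/-- The positive semidefinite inner product on formal combinations of elementary tensors. -/
instance preTensorCore (p : PMF Site) : PreInnerProductSpace.Core ℂ (PreTensor p) where
  inner x y := preInner x y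
  conj_inner_symm x y := by
    change (starRingEnd ℂ) (preInner _ _) = preInner _ _
    simp only [preInner, Finsupp.sum, map_sum, map_mul, Complex.conj_conj, elemInner_conj]
    rw [Finset.sum_comm]
    refine Finset.sum_congr rfl fun a _ => Finset.sum_congr rfl fun b _ => ?_
    ring
  re_inner_nonneg x := preInner_self x
  add_left x y z := by
    refine Finsupp.sum_add_index' (f := (x : ElemTensor p →₀ ℂ)) (fun a => ?_) fun a c d => ?_
    · simp only [map_zero, zero_mul]
      exact Finset.sum_const_zero
    · simp only [map_add, add_mul]
      exact Finset.sum_add_distrib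
  smul_left x y r := by
    refine (Finsupp.sum_smul_index (g := (x : ElemTensor p →₀ ℂ)) fun a => ?_).trans ?_
    · simp only [map_zero, zero_mul]
      exact Finset.sum_const_zero
    · simp only [preInner, Finsupp.sum, map_mul, Finset.mul_sum, mul_assoc]

instance (p : PMF Site) : SeminormedAddCommGroup (PreTensor p) :=
  InnerProductSpace.Core.toSeminormedAddCommGroup (𝕜 := ℂ)

instance (p : PMF Site) : InnerProductSpace ℂ (PreTensor p) :=
  InnerProductSpace.ofCore (preTensorCore p)

/-- An elementary tensor as a formal linear combination. -/
def preTensor {p : PMF Site} (a : ElemTensor p) : PreTensor p :=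
  (Finsupp.single a 1 : ElemTensor p →₀ ℂ)

/-- The infinite tensor product `𝔥 = ⨂_i (M₂(ℂ), Tr(b^* a), 𝔍_i(𝕀))`: the Hilbert space
completion of the span of the elementary tensors. -/
abbrev TensorH (p : PMF Site) : Type := UniformSpace.Completion (PreTensor p)

/-- The elementary tensor `a₀ ⊗ a₁ ⊗ ⋯` as a vector of `𝔥`. -/
def tensor {p : PMF Site} (a : ElemTensor p) : TensorH p :=
  (preTensor a : TensorH p)

/-- The vector `ξ = 𝔍_0(𝕀) ⊗ 𝔍_1(𝕀) ⊗ ⋯`. -/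
def refVector (p : PMF Site) : TensorH p :=
  tensor ⟨fun _ => refMatrix p, Eventually.of_forall fun _ => rfl⟩

/-! ### The identification `𝔍 = ⨂ 𝔍_i` -/

/-- The function `x ↦ ∏_{i < n} f_i(x_i)` as an element of `L²(X, μ)`. -/
def elemFun (p : PMF Site) (n : ℕ) (f : ℕ → Site → ℂ) : L2X p :=
  MemLp.toLp (μ := prodMeasure p) (p := 2) (fun x => ∏ i ∈ Finset.range n, f i (x i)) <| by
    refine MemLp.of_bound (Measurable.aestronglyMeasurable ?_)
      (∏ i ∈ Finset.range n, ∑ z, ‖f i z‖) (Eventually.of_forall fun x => ?_)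
    · exact Finset.measurable_prod _ fun i _ =>
        (measurable_of_finite (f i)).comp (measurable_pi_apply i)
    · rw [norm_prod]
      exact Finset.prod_le_prod (fun _ _ => norm_nonneg _) fun i _ =>
        Finset.single_le_sum (f := fun z => ‖f i z‖) (fun _ _ => norm_nonneg _)
          (Finset.mem_univ (x i))

/-- The elementary tensor `𝔍_0 f_0 ⊗ ⋯ ⊗ 𝔍_{n-1} f_{n-1} ⊗ 𝔍_n(𝕀) ⊗ 𝔍_{n+1}(𝕀) ⊗ ⋯`. -/
def elemFunTensor (p : PMF Site) (n : ℕ) (f : ℕ → Site → ℂ) : ElemTensor p :=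
  ⟨fun i => if i < n then siteMatrix p (f i) else refMatrix p,
    eventually_atTop.2 ⟨n, fun i hi => by simp [not_lt.2 hi]⟩⟩

/-- `J` is the unitary `𝔍 = ⨂ 𝔍_i : L²(X, μ) → 𝔥`. -/
def IsTensorId (p : PMF Site) (J : L2X p ≃ₗᵢ[ℂ] TensorH p) : Prop :=
  ∀ (n : ℕ) (f : ℕ → Site → ℂ), J (elemFun p n f) = tensor (elemFunTensor p n f)

/-! ### The algebras of left and of right multiplications -/

/-- The double commutant of a set of bounded operators. -/
def doubleCommutant {H : Type*} [NormedAddCommGroup H] [InnerProductSpace ℂ H]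
    (S : Set (H →L[ℂ] H)) : Set (H →L[ℂ] H) :=
  Set.centralizer (Set.centralizer S)

/-- The `W^*`-algebra generated by a set of bounded operators. -/
def wstarGenerated {H : Type*} [NormedAddCommGroup H] [InnerProductSpace ℂ H] [CompleteSpace H]
    (S : Set (H →L[ℂ] H)) : Set (H →L[ℂ] H) :=
  doubleCommutant (S ∪ star '' S)

/-- Elements `b₀ ⊗ b₁ ⊗ ⋯ ⊗ b_{n-1} ⊗ I₂ ⊗ I₂ ⊗ ⋯`. -/
structure LocalElem where
  /-- the sequence of factors -/
  toFun : ℕ → M2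
  eventually_one : ∀ᶠ i in atTop, toFun i = 1

/-- The elementary tensor `b₀a₀ ⊗ b₁a₁ ⊗ ⋯`. -/
def LocalElem.mulLeft {p : PMF Site} (b : LocalElem) (a : ElemTensor p) : ElemTensor p :=
  ⟨fun i => b.toFun i * a.toFun i, by
    filter_upwards [b.eventually_one, a.eventually_ref] with i h₁ h₂
    rw [h₁, h₂, one_mul]⟩

/-- The elementary tensor `a₀b₀ ⊗ a₁b₁ ⊗ ⋯`. -/
def LocalElem.mulRight {p : PMF Site} (b : LocalElem) (a : ElemTensor p) : ElemTensor p :=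
  ⟨fun i => a.toFun i * b.toFun i, by
    filter_upwards [b.eventually_one, a.eventually_ref] with i h₁ h₂
    rw [h₁, h₂, mul_one]⟩

/-- `T` is the operator of left multiplication by `b` in `𝔥`. -/
def IsLeftMul {p : PMF Site} (b : LocalElem) (T : TensorH p →L[ℂ] TensorH p) : Prop :=
  ∀ a : ElemTensor p, T (tensor a) = tensor (b.mulLeft a)

/-- `T` is the operator of right multiplication by `b` in `𝔥`. -/
def IsRightMul {p : PMF Site} (b : LocalElem) (T : TensorH p →L[ℂ] TensorH p) : Prop :=
  ∀ a : ElemTensor p, T (tensor a) = tensor (b.mulRight a)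

/-- The `W^*`-algebra `ℒ(𝔥)` generated by the left multiplications. -/
def leftAlg (p : PMF Site) : Set (TensorH p →L[ℂ] TensorH p) :=
  wstarGenerated {T | ∃ b : LocalElem, IsLeftMul b T}

/-- The `W^*`-algebra `ℛ(𝔥)` generated by the right multiplications. -/
def rightAlg (p : PMF Site) : Set (TensorH p →L[ℂ] TensorH p) :=
  wstarGenerated {T | ∃ b : LocalElem, IsRightMul b T}

/-- `𝔍⁻¹ T 𝔍`. -/
def pullOp {p : PMF Site} (J : L2X p ≃ₗᵢ[ℂ] TensorH p) (T : TensorH p →L[ℂ] TensorH p) :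
    L2X p →L[ℂ] L2X p :=
  (J.symm.toContinuousLinearEquiv : TensorH p →L[ℂ] L2X p) ∘L T ∘L
    (J.toContinuousLinearEquiv : L2X p →L[ℂ] TensorH p)

/-- `𝔍 T 𝔍⁻¹`. -/
def pushOp {p : PMF Site} (J : L2X p ≃ₗᵢ[ℂ] TensorH p) (T : L2X p →L[ℂ] L2X p) :
    TensorH p →L[ℂ] TensorH p :=
  (J.toContinuousLinearEquiv : L2X p →L[ℂ] TensorH p) ∘L T ∘L
    (J.symm.toContinuousLinearEquiv : TensorH p →L[ℂ] L2X p)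

/-! ### Tomita-Takesaki theory -/

section Tomita

variable {H : Type*} [NormedAddCommGroup H] [InnerProductSpace ℂ H] [CompleteSpace H]

/-- The closure of the graph of the antilinear operator `aξ ↦ a^*ξ`, `a ∈ M`. -/
def tomitaGraph (M : Set (H →L[ℂ] H)) (ξ : H) : Set (H × H) :=
  closure {z | ∃ a ∈ M, z = (a ξ, (star a) ξ)}

/-- `Δ` is the modular operator of `(M, ξ)`, where `M` and `N` are commuting algebras: `ξ` is
cyclic and separating for `M`, the antilinear operators `aξ ↦ a^*ξ` (`a ∈ M`) and
`a'ξ ↦ a'^*ξ` (`a' ∈ N`) have closures `S` and `F`, `F = S^*`, and `Δ = F S`. -/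
structure IsModularOperator (M N : Set (H →L[ℂ] H)) (ξ : H) (Δ : H →ₗ.[ℂ] H) : Prop where
  cyclic : Dense {v : H | ∃ a ∈ M, v = a ξ}
  separating : ∀ a ∈ M, a ξ = 0 → a = 0
  closable_S : ∀ u v w, (u, v) ∈ tomitaGraph M ξ → (u, w) ∈ tomitaGraph M ξ → v = w
  closable_F : ∀ u v w, (u, v) ∈ tomitaGraph N ξ → (u, w) ∈ tomitaGraph N ξ → v = w
  adjoint : ∀ u v, (u, v) ∈ tomitaGraph N ξ ↔
    ∀ x y, (x, y) ∈ tomitaGraph M ξ → inner ℂ y u = inner ℂ v x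
  graph : ∀ u w, (u, w) ∈ Δ.graph ↔
    ∃ v, (u, v) ∈ tomitaGraph M ξ ∧ (v, w) ∈ tomitaGraph N ξ

end Tomita

/-- The span of the vectors `aξ`, where `a = a₀ ⊗ ⋯ ⊗ a_{n-1} ⊗ I₂ ⊗ I₂ ⊗ ⋯`. -/
def localVectors (p : PMF Site) : Submodule ℂ (TensorH p) :=
  Submodule.span ℂ {v | ∃ (a : LocalElem) (A : TensorH p →L[ℂ] TensorH p),
    IsLeftMul a A ∧ v = A (refVector p)}

/-- The operator `⨂_{j < n} 𝔍_j 𝒪_j^{(0,j)} 𝔍_j⁻¹ = ∏_{j < n} 𝔍 𝒪_j 𝔍⁻¹`. -/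
def okounkovProd {p : PMF Site} (J : L2X p ≃ₗᵢ[ℂ] TensorH p)
    (O : ℕ → (L2X p →L[ℂ] L2X p)) (n : ℕ) : TensorH p →L[ℂ] TensorH p :=
  ((List.range n).map fun j => pushOp J (O j)).prod

end

/-! Write $m$ for `refMatrix p`. Carried over by $\mathfrak J$, a function on $X$ becomes a tensor
of $2\times2$ matrices. A permutation of the coordinates $x^{(0)}$ acts on row indices and one of
the coordinates $x^{(1)}$ on column indices, so the two copies of $G$ act by left and by right
multiplications. Precisely, the transposition $(k,l)$ is the flip $\sum_{i,j}E_{ij}\otimes E_{ji}$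
at the sites $k,l$ (`conj_transp`), and a sign character is a product of copies of
$\mathrm{diag}(1,-1)$ (`conj_gamma`).

Generated algebras. What commutes with all one-sided multiplications therefore commutes with the
group. Conversely, average the flips over $l$. By a law of large numbers (`tendsto_average_siteOp`)
the factor $E_{ji}$ at the moving site becomes the scalar $\langle m,E_{ji}m\rangle$, so the average
converges strongly to multiplication at the site $k$ by a fixed matrix $Q$, on the left $Q=mm^*$.
Since all $p_{kl}>0$, the off-diagonal entries of $Q$ do not vanish, hence $Q$ and
$\mathrm{diag}(1,-1)$ generate $M_2(\mathbb C)$ (`subalgebra_eq_top`). Group and multiplications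
thus have the same commutant (`doubleCommutant_rep`).

Modular theory. Let $K_n$ be the finite-dimensional span of the tensors equal to $m$ from the site
$n$ on. If $m$ is invertible, every vector of $K_n$ is $a\xi$ for a left and $b\xi$ for a right
multiplication operator, with $a^*\xi,b^*\xi\in K_n$ too. This alone (`TomitaPair`) yields the
theory: a pair satisfying the adjoint relation with one algebra is compressed by the projection onto
$K_n$ to a pair $(a\xi,a^*\xi)$ of the other (`exists_compression`). Letting $n\to\infty$ gives
$F=S^*$, and the same compression applied to $FS$ makes $\bigcup K_n$ a core.

The formula for $\Delta_\xi$ is a matrix identity at each site: $a^*m=m(m^{-1}a^*m)$ turns $S(a\xi)$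
into a right multiplication applied to $\xi$, and applying $F$ gives $m(m^{-1}a^*m)^*=QaQ^{-1}m$. -/

noncomputable section

/-! ### Elementary tensors -/

namespace ElemTensor

variable {p : PMF Site}

/-- Replace the factor at the site `k`. -/
def update (a : ElemTensor p) (k : ℕ) (x : M2) : ElemTensor p :=
  ⟨Function.update a.toFun k x, by
    filter_upwards [a.eventually_ref, eventually_gt_atTop k] with i h₁ h₂
    rw [Function.update_of_ne h₂.ne', h₁]⟩

@[ext] lemma ext {a b : ElemTensor p} (h : ∀ i, a.toFun i = b.toFun i) : a = b := by
  cases a; cases b; congr; exact funext h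

@[simp] lemma update_same (a : ElemTensor p) (k : ℕ) (x : M2) : (a.update k x).toFun k = x :=
  Function.update_self _ _ _

@[simp] lemma update_of_ne (a : ElemTensor p) {k i : ℕ} (h : i ≠ k) (x : M2) :
    (a.update k x).toFun i = a.toFun i :=
  Function.update_of_ne h _ _

lemma update_eq_self (a : ElemTensor p) (k : ℕ) : a.update k (a.toFun k) = a :=
  ext fun i => by simp [update]

lemma update_update (a : ElemTensor p) (k : ℕ) (x y : M2) :
    (a.update k x).update k y = a.update k y :=
  ext fun i => by simp [update]

end ElemTensor

variable {p : PMF Site}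

/-- The Hilbert-Schmidt inner product. -/
def hs (x y : M2) : ℂ := (x.conjTranspose * y).trace

lemma hs_add_right (x y z : M2) : hs x (y + z) = hs x y + hs x z := by
  simp [hs, Matrix.mul_add]

lemma hs_smul_right (c : ℂ) (x y : M2) : hs x (c • y) = c * hs x y := by
  simp [hs]

lemma hs_conj (x y : M2) : (starRingEnd ℂ) (hs x y) = hs y x := by
  rw [hs, starRingEnd_apply, ← Matrix.trace_conjTranspose, Matrix.conjTranspose_mul,
    Matrix.conjTranspose_conjTranspose, hs]

lemma hs_refMatrix (p : PMF Site) : hs (refMatrix p) (refMatrix p) = 1 := trace_refMatrix p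

lemma hs_apply (x y : M2) : hs x y = ∑ z : Site, (starRingEnd ℂ) (x z.1 z.2) * y z.1 z.2 := by
  rw [Fintype.sum_prod_type, Finset.sum_comm]
  rfl

/-- Putting the unit vector $m$ into the slot $k$ on both sides replaces that factor of the product
by $1$, so the factor can be split off. -/
lemma elemInner_factor (a b : ElemTensor p) (k : ℕ) :
    elemInner a b = hs (a.toFun k) (b.toFun k) *
      elemInner (a.update k (refMatrix p)) (b.update k (refMatrix p)) := by
  obtain ⟨N, hN⟩ := eventually_atTop.1
    ((a.eventually_ref.and b.eventually_ref).and (eventually_gt_atTop k))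
  have hk : k ∈ Finset.range N := by
    by_contra h
    exact lt_irrefl _ (hN k (by simpa using h)).2
  rw [elemInner_eq_prod a b N (fun i hi => (hN i hi).1.1) (fun i hi => (hN i hi).1.2),
    elemInner_eq_prod _ _ N
      (fun i hi => by rw [ElemTensor.update_of_ne _ (hN i hi).2.ne', (hN i hi).1.1])
      (fun i hi => by rw [ElemTensor.update_of_ne _ (hN i hi).2.ne', (hN i hi).1.2]),
    ← Finset.mul_prod_erase _ _ hk, ← Finset.mul_prod_erase _ _ hk]
  rw [ElemTensor.update_same, ElemTensor.update_same, trace_refMatrix, one_mul, hs]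
  congr 1
  refine Finset.prod_congr rfl fun i hi => ?_
  rw [ElemTensor.update_of_ne _ (Finset.ne_of_mem_erase hi),
    ElemTensor.update_of_ne _ (Finset.ne_of_mem_erase hi)]

lemma elemInner_update_right (a b : ElemTensor p) (k : ℕ) (x : M2) :
    elemInner a (b.update k x) = hs (a.toFun k) x *
      elemInner (a.update k (refMatrix p)) (b.update k (refMatrix p)) := by
  rw [elemInner_factor _ _ k, ElemTensor.update_same, ElemTensor.update_update]

lemma elemInner_congr {a b a' b' : ElemTensor p}
    (h : ∀ i, hs (a.toFun i) (b.toFun i) = hs (a'.toFun i) (b'.toFun i)) :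
    elemInner a b = elemInner a' b' :=
  finprod_congr h

/-! ### The vectors `tensor a` -/

lemma inner_tensor (a b : ElemTensor p) : inner ℂ (tensor a) (tensor b) = elemInner a b := by
  refine (UniformSpace.Completion.inner_coe _ _).trans ?_
  change preInner (Finsupp.single a 1) (Finsupp.single b 1) = _
  simp [preInner]

lemma span_preTensor : Submodule.span ℂ (Set.range (preTensor (p := p))) = ⊤ := by
  have key : ∀ x : ElemTensor p →₀ ℂ,
      (x : PreTensor p) ∈ Submodule.span ℂ (Set.range (preTensor (p := p))) := fun x => by
    induction x using Finsupp.induction_linear with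
    | zero => exact Submodule.zero_mem _
    | add x y hx hy => exact Submodule.add_mem _ hx hy
    | single a c =>
      have h : (Finsupp.single a c : ElemTensor p →₀ ℂ)
          = c • (Finsupp.single a 1 : ElemTensor p →₀ ℂ) := by simp
      rw [h]
      exact (Submodule.span ℂ (Set.range (preTensor (p := p)))).smul_mem c
        (Submodule.subset_span ⟨a, rfl⟩)
  exact eq_top_iff.2 fun x _ => key x

lemma dense_span_tensor :
    Dense (Submodule.span ℂ (Set.range (tensor (p := p))) : Set (TensorH p)) := by
  have h : Submodule.span ℂ (Set.range (tensor (p := p)))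
      = LinearMap.range
        (UniformSpace.Completion.toComplₗᵢ (𝕜 := ℂ) (E := PreTensor p)).toLinearMap := by
    rw [← Submodule.map_top, ← span_preTensor, Submodule.map_span, ← Set.range_comp]
    rfl
  rw [h]
  exact UniformSpace.Completion.denseRange_coe

lemma TensorH.ext_inner {x y : TensorH p}
    (h : ∀ a : ElemTensor p, inner ℂ (tensor a) x = inner ℂ (tensor a) y) : x = y := by
  refine dense_span_tensor.eq_of_inner_right (𝕜 := ℂ) fun v hv => ?_
  induction hv using Submodule.span_induction with
  | mem v hv => obtain ⟨a, rfl⟩ := hv; exact h a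
  | zero => simp
  | add u v _ _ hu hv => rw [inner_add_left, inner_add_left, hu, hv]
  | smul c u _ hu => rw [inner_smul_left, inner_smul_left, hu]

lemma TensorH.clm_ext {E : Type*} [NormedAddCommGroup E] [NormedSpace ℂ E]
    {S T : TensorH p →L[ℂ] E} (h : ∀ a : ElemTensor p, S (tensor a) = T (tensor a)) : S = T := by
  refine ContinuousLinearMap.ext_on dense_span_tensor ?_
  rintro _ ⟨a, rfl⟩
  exact h a

/-- `x ↦ a₀ ⊗ ⋯ ⊗ a_{k-1} ⊗ x ⊗ a_{k+1} ⊗ ⋯` -/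
def slot (a : ElemTensor p) (k : ℕ) : M2 →ₗ[ℂ] TensorH p where
  toFun x := tensor (a.update k x)
  -- Vectors are classes of formal combinations, so multilinearity is not built in. It holds because
  -- both sides have the same inner product with every elementary tensor.
  map_add' x y := TensorH.ext_inner fun c => by
    rw [inner_add_right]
    rw [inner_tensor, inner_tensor, inner_tensor, elemInner_update_right c,
      elemInner_update_right c, elemInner_update_right c, hs_add_right, add_mul]
  map_smul' r x := TensorH.ext_inner fun c => by
    rw [RingHom.id_apply, inner_smul_right]
    rw [inner_tensor, inner_tensor, elemInner_update_right c, elemInner_update_right c,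
      hs_smul_right, mul_assoc]

lemma slot_apply (a : ElemTensor p) (k : ℕ) (x : M2) : slot a k x = tensor (a.update k x) := rfl

lemma slot_self (a : ElemTensor p) (k : ℕ) : slot a k (a.toFun k) = tensor a := by
  rw [slot_apply, ElemTensor.update_eq_self]

/-- A family of vectors with the inner products of the elementary tensors defines an isometry. -/
lemma exists_isometry_of_inner {E : Type*} [NormedAddCommGroup E] [InnerProductSpace ℂ E]
    [CompleteSpace E] (F : ElemTensor p → E)
    (hF : ∀ a b, inner ℂ (F a) (F b) = elemInner a b) :
    ∃ V : TensorH p →ₗᵢ[ℂ] E, ∀ a, V (tensor a) = F a := by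
  let L : PreTensor p →ₗ[ℂ] E := Finsupp.linearCombination ℂ F
  have hLa : ∀ a, L (preTensor a) = F a := fun a => by
    change Finsupp.linearCombination ℂ F (Finsupp.single a 1) = _
    simp
  have hL : ∀ x y : PreTensor p, inner ℂ (L x) (L y) = inner ℂ x y := by
    have key : ∀ x y : ElemTensor p →₀ ℂ, inner ℂ (Finsupp.linearCombination ℂ F x)
        (Finsupp.linearCombination ℂ F y) = preInner x y := fun x y => by
      simp only [Finsupp.linearCombination_apply, Finsupp.sum, sum_inner, inner_sum,
        inner_smul_left, inner_smul_right, hF, preInner, mul_assoc, Finset.mul_sum]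
      rw [Finset.sum_comm]
      exact Finset.sum_congr rfl fun _ _ => Finset.sum_congr rfl fun _ _ => by ring
    exact key
  have hn : ∀ x, ‖L x‖ = ‖x‖ := fun x => by
    rw [@norm_eq_sqrt_re_inner ℂ, hL, ← @norm_eq_sqrt_re_inner ℂ]
  let L' : PreTensor p →ₗᵢ[ℂ] E := ⟨L, hn⟩
  have hd : DenseRange (UniformSpace.Completion.toComplL (𝕜 := ℂ) (E := PreTensor p)) :=
    UniformSpace.Completion.denseRange_coe
  have hu : IsUniformInducing (UniformSpace.Completion.toComplL (𝕜 := ℂ) (E := PreTensor p)) :=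
    UniformSpace.Completion.isUniformInducing_coe _
  let T : TensorH p →L[ℂ] E :=
    L'.toContinuousLinearMap.extend (UniformSpace.Completion.toComplL (𝕜 := ℂ) (E := PreTensor p))
  have hT : ∀ x : PreTensor p, T (x : TensorH p) = L x := fun x =>
    ContinuousLinearMap.extend_eq _ hd hu x
  refine ⟨⟨T.toLinearMap, fun x => ?_⟩, fun a => (hT _).trans (hLa a)⟩
  change ‖T x‖ = ‖x‖
  induction x using UniformSpace.Completion.induction_on with
  | hp => exact isClosed_eq (by fun_prop) (by fun_prop)
  | ih x => rw [hT, hn, UniformSpace.Completion.norm_coe]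

/-! ### Operators acting on one factor -/

/-- Preservation of inner products makes boundedness automatic. General one-site operators are then
obtained as combinations and products of these isometries, with no norm estimate. -/
lemma exists_siteOp_of_isometry (k : ℕ) (t : Module.End ℂ M2)
    (ht : ∀ x y, hs (t x) (t y) = hs x y) :
    ∃ T : TensorH p →L[ℂ] TensorH p, ∀ a, T (tensor a) = slot a k (t (a.toFun k)) := by
  obtain ⟨V, hV⟩ := exists_isometry_of_inner (p := p)
    (fun a => slot a k (t (a.toFun k))) fun a b => by
      rw [slot_apply, slot_apply, inner_tensor]
      refine elemInner_congr fun i => ?_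
      by_cases h : i = k
      · subst h
        simp [ht]
      · simp [h]
  exact ⟨V.toContinuousLinearMap, hV⟩

lemma exists_siteOp_comb (k : ℕ) {s t : Module.End ℂ M2} (c d : ℂ)
    (hs : ∃ T : TensorH p →L[ℂ] TensorH p, ∀ a, T (tensor a) = slot a k (s (a.toFun k)))
    (ht : ∃ T : TensorH p →L[ℂ] TensorH p, ∀ a, T (tensor a) = slot a k (t (a.toFun k))) :
    ∃ T : TensorH p →L[ℂ] TensorH p,
      ∀ a, T (tensor a) = slot a k ((c • s + d • t) (a.toFun k)) := by
  obtain ⟨S, hS⟩ := hs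
  obtain ⟨T, hT⟩ := ht
  exact ⟨c • S + d • T, fun a => by simp [hS, hT]⟩

lemma exists_siteOp_mul (k : ℕ) {s t : Module.End ℂ M2}
    (hs : ∃ T : TensorH p →L[ℂ] TensorH p, ∀ a, T (tensor a) = slot a k (s (a.toFun k)))
    (ht : ∃ T : TensorH p →L[ℂ] TensorH p, ∀ a, T (tensor a) = slot a k (t (a.toFun k))) :
    ∃ T : TensorH p →L[ℂ] TensorH p,
      ∀ a, T (tensor a) = slot a k ((s * t) (a.toFun k)) := by
  obtain ⟨S, hS⟩ := hs
  obtain ⟨T, hT⟩ := ht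
  exact ⟨S * T, fun a => by
    simp [hT, hS, slot_apply, ElemTensor.update_update]⟩

/-- The four matrices on the right are unitary, so multiplication by each of them is an isometry for
the Hilbert-Schmidt inner product. -/
lemma M2.eq_comb_unitaries (e : M2) :
    e = ((e 0 0 + e 1 1) / 2) • (1 : M2) + ((e 0 0 - e 1 1) / 2) • !![1, 0; 0, -1]
      + (((e 0 1 + e 1 0) / 2) • !![0, 1; 1, 0] + ((e 0 1 - e 1 0) / 2) • !![0, 1; -1, 0]) := by
  ext i j
  fin_cases i <;> fin_cases j <;> simp <;> ring

lemma hs_mul_left (e x y : M2) : hs (e * x) y = hs x (e.conjTranspose * y) := by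
  simp only [hs, Matrix.conjTranspose_mul, Matrix.mul_assoc]

lemma hs_mul_right (e x y : M2) : hs (x * e) y = hs x (y * e.conjTranspose) := by
  rw [hs, hs, Matrix.conjTranspose_mul, Matrix.mul_assoc, Matrix.trace_mul_comm, Matrix.mul_assoc]

lemma exists_siteOp_mulLeft (k : ℕ) (e : M2) :
    ∃ T : TensorH p →L[ℂ] TensorH p,
      ∀ a, T (tensor a) = slot a k (LinearMap.mulLeft ℂ e (a.toFun k)) := by
  have hu : ∀ u : M2, u.conjTranspose * u = 1 → ∃ T : TensorH p →L[ℂ] TensorH p,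
      ∀ a, T (tensor a) = slot a k (LinearMap.mulLeft ℂ u (a.toFun k)) := fun u hu =>
    exists_siteOp_of_isometry k _ fun x y => by
      simp only [LinearMap.mulLeft_apply]
      rw [hs_mul_left, ← Matrix.mul_assoc, hu, Matrix.one_mul]
  have key := exists_siteOp_comb k 1 1
    (exists_siteOp_comb k ((e 0 0 + e 1 1) / 2) ((e 0 0 - e 1 1) / 2)
      (hu 1 (by simp)) (hu !![1, 0; 0, -1] (by
        ext i j; fin_cases i <;> fin_cases j <;> simp [Matrix.mul_apply])))
    (exists_siteOp_comb k ((e 0 1 + e 1 0) / 2) ((e 0 1 - e 1 0) / 2)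
      (hu !![0, 1; 1, 0] (by
        ext i j; fin_cases i <;> fin_cases j <;> simp [Matrix.mul_apply]))
      (hu !![0, 1; -1, 0] (by
        ext i j; fin_cases i <;> fin_cases j <;> simp [Matrix.mul_apply])))
  obtain ⟨T, hT⟩ := key
  refine ⟨T, fun a => (hT a).trans (congrArg _ ?_)⟩
  conv_rhs => rw [M2.eq_comb_unitaries e]
  simp only [LinearMap.add_apply, LinearMap.smul_apply, LinearMap.mulLeft_apply, add_mul,
    smul_mul_assoc, one_smul]

lemma exists_siteOp_mulRight (k : ℕ) (e : M2) :
    ∃ T : TensorH p →L[ℂ] TensorH p,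
      ∀ a, T (tensor a) = slot a k (LinearMap.mulRight ℂ e (a.toFun k)) := by
  have hu : ∀ u : M2, u * u.conjTranspose = 1 → ∃ T : TensorH p →L[ℂ] TensorH p,
      ∀ a, T (tensor a) = slot a k (LinearMap.mulRight ℂ u (a.toFun k)) := fun u hu =>
    exists_siteOp_of_isometry k _ fun x y => by
      simp only [LinearMap.mulRight_apply]
      rw [hs_mul_right, Matrix.mul_assoc, hu, Matrix.mul_one]
  have key := exists_siteOp_comb k 1 1
    (exists_siteOp_comb k ((e 0 0 + e 1 1) / 2) ((e 0 0 - e 1 1) / 2)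
      (hu 1 (by simp)) (hu !![1, 0; 0, -1] (by
        ext i j; fin_cases i <;> fin_cases j <;> simp [Matrix.mul_apply])))
    (exists_siteOp_comb k ((e 0 1 + e 1 0) / 2) ((e 0 1 - e 1 0) / 2)
      (hu !![0, 1; 1, 0] (by
        ext i j; fin_cases i <;> fin_cases j <;> simp [Matrix.mul_apply]))
      (hu !![0, 1; -1, 0] (by
        ext i j; fin_cases i <;> fin_cases j <;> simp [Matrix.mul_apply])))
  obtain ⟨T, hT⟩ := key
  refine ⟨T, fun a => (hT a).trans (congrArg _ ?_)⟩
  conv_rhs => rw [M2.eq_comb_unitaries e]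
  simp only [LinearMap.add_apply, LinearMap.smul_apply, LinearMap.mulRight_apply, mul_add,
    mul_smul_comm, one_smul]

/-- Since $E_{z_1w_1}\,x\,E_{w_2z_2}=x_{w_1w_2}E_{z_1z_2}$, the two-sided multiplications by matrix
units are the matrix units of $\operatorname{End}(M_2)$. -/
lemma M2.end_eq_sum (t : Module.End ℂ M2) :
    t = ∑ z : Site, ∑ w : Site, t (Matrix.single w.1 w.2 1) z.1 z.2 •
      (LinearMap.mulLeft ℂ (Matrix.single z.1 w.1 (1 : ℂ) : M2) *
        LinearMap.mulRight ℂ (Matrix.single w.2 z.2 (1 : ℂ) : M2)) := by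
  refine LinearMap.ext fun x => Matrix.ext fun i j => ?_
  have hx : t x = ∑ w : Site, x w.1 w.2 • t (Matrix.single w.1 w.2 1) := by
    conv_lhs => rw [Matrix.matrix_eq_sum_single x]
    simp only [Fintype.sum_prod_type, map_sum, ← map_smul, Matrix.smul_single, smul_eq_mul, mul_one]
  rw [hx]
  simp only [LinearMap.sum_apply, LinearMap.smul_apply, Module.End.mul_apply,
    LinearMap.mulLeft_apply, LinearMap.mulRight_apply, Matrix.sum_apply, Matrix.smul_apply]
  fin_cases i <;> fin_cases j <;>
    simp [Fintype.sum_prod_type, Matrix.mul_apply, Matrix.single_apply, mul_comm]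

lemma exists_siteOp (k : ℕ) (t : Module.End ℂ M2) :
    ∃ T : TensorH p →L[ℂ] TensorH p, ∀ a, T (tensor a) = slot a k (t (a.toFun k)) := by
  have h : ∀ z w : Site, ∃ T : TensorH p →L[ℂ] TensorH p, ∀ a, T (tensor a) = slot a k
      ((LinearMap.mulLeft ℂ (Matrix.single z.1 w.1 (1 : ℂ) : M2) *
        LinearMap.mulRight ℂ (Matrix.single w.2 z.2 (1 : ℂ) : M2)) (a.toFun k)) := fun z w =>
    exists_siteOp_mul k (exists_siteOp_mulLeft k _) (exists_siteOp_mulRight k _)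
  choose T hT using h
  refine ⟨∑ z : Site, ∑ w : Site, t (Matrix.single w.1 w.2 1) z.1 z.2 • T z w, fun a => ?_⟩
  conv_rhs => rw [M2.end_eq_sum t]
  simp only [_root_.sum_apply, _root_.smul_apply, hT, LinearMap.sum_apply,
    LinearMap.smul_apply, map_sum, map_smul]

/-- The operator acting by `t` on the factor at the site `k`, as a plain function of `t`. -/
def siteOpFun (k : ℕ) (t : Module.End ℂ M2) : TensorH p →L[ℂ] TensorH p :=
  (exists_siteOp k t).choose

lemma siteOpFun_tensor (k : ℕ) (t : Module.End ℂ M2) (a : ElemTensor p) :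
    siteOpFun k t (tensor a) = slot a k (t (a.toFun k)) :=
  (exists_siteOp k t).choose_spec a

/-- The operator acting by `t` on the factor at the site `k`. -/
def siteOp (k : ℕ) : Module.End ℂ M2 →ₐ[ℂ] (TensorH p →L[ℂ] TensorH p) :=
  AlgHom.ofLinearMap
    { toFun := siteOpFun k
      map_add' := fun s t => TensorH.clm_ext fun a => by simp [siteOpFun_tensor]
      map_smul' := fun c t => TensorH.clm_ext fun a => by simp [siteOpFun_tensor] }
    (TensorH.clm_ext fun a => by simp [siteOpFun_tensor, slot_self])
    fun s t => TensorH.clm_ext fun a => by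
      simp [siteOpFun_tensor, slot_apply, ElemTensor.update_update]

lemma siteOp_tensor (k : ℕ) (t : Module.End ℂ M2) (a : ElemTensor p) :
    siteOp k t (tensor a) = tensor (a.update k (t (a.toFun k))) :=
  siteOpFun_tensor k t a

/-! ### Left and right multiplications -/

/-- `e ↦ (x ↦ e x)` for `σ = false` and `e ↦ (x ↦ x eᵀ)` for `σ = true`. -/
def side : Bool → M2 →ₐ[ℂ] Module.End ℂ M2
  | false => Algebra.lmul ℂ M2
  | true => AlgHom.ofLinearMap
      -- Right multiplication reverses products; the transpose makes it a homomorphism, so that both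
      -- sides can be treated by the same arguments.
      { toFun := fun e => LinearMap.mulRight ℂ e.transpose
        map_add' := fun e f => by ext1; simp [mul_add]
        map_smul' := fun c e => by ext1; simp }
      (by ext1; simp) fun e f => LinearMap.ext fun x => by
        simp [Matrix.transpose_mul, Matrix.mul_assoc]

@[simp] lemma side_false (e x : M2) : side false e x = e * x := rfl

@[simp] lemma side_true (e x : M2) : side true e x = x * e.transpose := rfl

lemma hs_side (σ : Bool) (e x y : M2) : hs (side σ e x) y = hs x (side σ e.conjTranspose y) := by
  cases σ
  · exact hs_mul_left e x y
  · exact hs_mul_right _ x y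

lemma side_commute (e f : M2) : Commute (side false e) (side true f) :=
  LinearMap.ext fun x => by simp [Matrix.mul_assoc]

namespace LocalElem

@[ext] lemma ext {a b : LocalElem} (h : ∀ i, a.toFun i = b.toFun i) : a = b := by
  cases a; cases b; congr; exact funext h

/-- The factorwise image under a map fixing `1`. -/
def map (f : M2 → M2) (hf : f 1 = 1) (b : LocalElem) : LocalElem :=
  ⟨fun i => f (b.toFun i), b.eventually_one.mono fun i hi => by rw [hi, hf]⟩

/-- The element `1 ⊗ ⋯ ⊗ 1 ⊗ e ⊗ 1 ⊗ ⋯`. -/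
def single (k : ℕ) (e : M2) : LocalElem :=
  ⟨Function.update 1 k e, (eventually_gt_atTop k).mono fun i hi => by
    rw [Function.update_of_ne hi.ne', Pi.one_apply]⟩

/-- Factorwise action on elementary tensors, from the left or from the right. -/
def sideMul (σ : Bool) (b : LocalElem) (a : ElemTensor p) : ElemTensor p :=
  ⟨fun i => side σ (b.toFun i) (a.toFun i), by
    filter_upwards [b.eventually_one, a.eventually_ref] with i h₁ h₂
    rw [h₁, h₂, map_one, Module.End.one_apply]⟩

end LocalElem

/-- `T` is the operator of multiplication by `b` from the side `σ`. -/
def IsSideMul (σ : Bool) (b : LocalElem) (T : TensorH p →L[ℂ] TensorH p) : Prop :=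
  ∀ a : ElemTensor p, T (tensor a) = tensor (b.sideMul σ a)

lemma isRightMul_iff (b : LocalElem) (T : TensorH p →L[ℂ] TensorH p) :
    IsRightMul b T ↔ IsSideMul true (b.map Matrix.transpose Matrix.transpose_one) T :=
  Iff.rfl

/-- The `W^*`-algebra generated by the multiplications from the side `σ`. -/
def sideAlg (p : PMF Site) (σ : Bool) : Set (TensorH p →L[ℂ] TensorH p) :=
  wstarGenerated {T | ∃ b : LocalElem, IsSideMul σ b T}

lemma leftAlg_eq (p : PMF Site) : leftAlg p = sideAlg p false := rfl

lemma rightAlg_eq (p : PMF Site) : rightAlg p = sideAlg p true := by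
  unfold rightAlg sideAlg
  congr 1
  ext T
  refine ⟨fun ⟨b, hb⟩ => ⟨_, (isRightMul_iff b T).1 hb⟩, fun ⟨b, hb⟩ =>
    ⟨b.map Matrix.transpose Matrix.transpose_one, (isRightMul_iff _ T).2 ?_⟩⟩
  convert hb
  exact LocalElem.ext fun i => Matrix.transpose_transpose _

/-- The product of the operators `side σ (b i)` at the sites `i < n`. -/
def prodOp (σ : Bool) (b : ℕ → M2) : ℕ → (TensorH p →L[ℂ] TensorH p)
  | 0 => 1
  | n + 1 => prodOp σ b n * siteOp n (side σ (b n))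

lemma isSideMul_mul {σ : Bool} {b c d : LocalElem} {S T : TensorH p →L[ℂ] TensorH p}
    (hS : IsSideMul σ b S) (hT : IsSideMul σ c T)
    (h : ∀ i, d.toFun i = b.toFun i * c.toFun i) : IsSideMul σ d (S * T) := fun a => by
  rw [mul_apply_eq_comp, hT, hS]
  congr 1
  exact ElemTensor.ext fun i => by simp [LocalElem.sideMul, h, map_mul]

lemma isSideMul_one (σ : Bool) {b : LocalElem} (h : ∀ i, b.toFun i = 1) :
    IsSideMul (p := p) σ b 1 := fun a => by
  rw [one_apply_eq_self]
  congr 1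
  exact ElemTensor.ext fun i => by simp [LocalElem.sideMul, h]

lemma isSideMul_siteOp (σ : Bool) (k : ℕ) (e : M2) :
    IsSideMul (p := p) σ (LocalElem.single k e) (siteOp k (side σ e)) := fun a => by
  rw [siteOp_tensor]
  congr 1
  refine ElemTensor.ext fun i => ?_
  by_cases h : i = k
  · subst h; simp [LocalElem.single, LocalElem.sideMul]
  · simp [LocalElem.single, LocalElem.sideMul, h]

lemma isSideMul_prodOp (σ : Bool) (b : ℕ → M2) (n : ℕ) (c : LocalElem)
    (h₁ : ∀ i < n, c.toFun i = b i) (h₂ : ∀ i, n ≤ i → c.toFun i = 1) :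
    IsSideMul (p := p) σ c (prodOp σ b n) := by
  induction n generalizing c with
  | zero => exact isSideMul_one σ fun i => h₂ i (Nat.zero_le i)
  | succ n ih =>
    let d : LocalElem := ⟨Function.update c.toFun n 1, by
      filter_upwards [c.eventually_one, eventually_gt_atTop n] with i hi h
      rw [Function.update_of_ne h.ne', hi]⟩
    refine isSideMul_mul (b := d) (ih d (fun i hi => ?_) fun i hi => ?_)
      (isSideMul_siteOp σ n (b n)) fun i => ?_
    · simp [d, hi.ne, h₁ i (hi.trans (Nat.lt_succ_self n))]
    · by_cases h : i = n
      · simp [d, h]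
      · simp [d, h, h₂ i (by omega)]
    · by_cases h : i = n
      · subst h; simp [d, LocalElem.single, h₁]
      · simp [d, LocalElem.single, h]

lemma IsSideMul.unique {σ : Bool} {b : LocalElem} {S T : TensorH p →L[ℂ] TensorH p}
    (hS : IsSideMul σ b S) (hT : IsSideMul σ b T) : S = T :=
  TensorH.clm_ext fun a => (hS a).trans (hT a).symm

lemma exists_isSideMul (σ : Bool) (b : LocalElem) :
    ∃ T : TensorH p →L[ℂ] TensorH p, IsSideMul σ b T := by
  obtain ⟨N, hN⟩ := eventually_atTop.1 b.eventually_one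
  exact ⟨_, isSideMul_prodOp σ b.toFun N b (fun _ _ => rfl) hN⟩

lemma IsSideMul.star {σ : Bool} {b : LocalElem} {T : TensorH p →L[ℂ] TensorH p}
    (hT : IsSideMul σ b T) :
    IsSideMul σ (b.map Matrix.conjTranspose Matrix.conjTranspose_one) (star T) := fun a =>
  TensorH.ext_inner fun c => by
    rw [ContinuousLinearMap.star_eq_adjoint, ContinuousLinearMap.adjoint_inner_right, hT,
      inner_tensor, inner_tensor]
    exact elemInner_congr fun i => hs_side σ _ _ _

lemma isSideMul_commute {b c : LocalElem} {S T : TensorH p →L[ℂ] TensorH p}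
    (hS : IsSideMul false b S) (hT : IsSideMul true c T) : S * T = T * S :=
  TensorH.clm_ext fun a => by
    rw [mul_apply_eq_comp, mul_apply_eq_comp, hS, hT, hS, hT]
    congr 1
    exact ElemTensor.ext fun i => LinearMap.congr_fun (side_commute (b.toFun i) (c.toFun i)) _

/-! ### Cylinder functions in `L²(X, μ)` -/

lemma measurable_site_comp {α : Type*} [MeasurableSpace α] (f : Site → α) (i : ℕ) :
    Measurable fun x : ℕ → Site => f (x i) :=
  (measurable_of_finite f).comp (measurable_pi_apply i)

lemma integral_prod_sites (p : PMF Site) (N : ℕ) (h : ℕ → Site → ℂ) :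
    ∫ x, ∏ i ∈ Finset.range N, h i (x i) ∂prodMeasure p
      = ∏ i ∈ Finset.range N, ∑ z, ((p z).toReal : ℂ) * h i z := by
  have h₁ := integral_restrict_infinitePi (μ := fun _ : ℕ => p.toMeasure)
    (s := Finset.range N) (f := fun y => ∏ i : Finset.range N, h i (y i))
    (measurable_of_finite _).aestronglyMeasurable
  have h₂ : ∀ x : ℕ → Site, ∏ i : Finset.range N, h i ((Finset.range N).restrict x i)
      = ∏ i ∈ Finset.range N, h i (x i) := fun x => Finset.prod_coe_sort _ fun i => h i (x i)
  simp only [h₂] at h₁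
  rw [prodMeasure, h₁, integral_fintype_prod_eq_prod (μ := fun _ => p.toMeasure)
    (f := fun (i : Finset.range N) z => h i z)]
  simp only [PMF.integral_eq_sum, Complex.real_smul]
  exact Finset.prod_coe_sort _ fun i => ∑ z, ((p z).toReal : ℂ) * h i z

lemma hs_siteMatrix (f g : Site → ℂ) :
    hs (siteMatrix p f) (siteMatrix p g)
      = ∑ z, ((p z).toReal : ℂ) * ((starRingEnd ℂ) (f z) * g z) := by
  rw [hs_apply]
  refine Finset.sum_congr rfl fun z _ => ?_
  have : ((p z).toReal : ℂ) = (Real.sqrt (p z).toReal : ℂ) * (Real.sqrt (p z).toReal : ℂ) := by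
    rw [← Complex.ofReal_mul, Real.mul_self_sqrt ENNReal.toReal_nonneg]
  simp only [siteMatrix, Matrix.of_apply, map_mul, Complex.conj_ofReal, this]
  ring

lemma coeFn_elemFun (p : PMF Site) (n : ℕ) (f : ℕ → Site → ℂ) :
    (elemFun p n f : (ℕ → Site) → ℂ) =ᵐ[prodMeasure p]
      fun x => ∏ i ∈ Finset.range n, f i (x i) :=
  MemLp.coeFn_toLp _

lemma prod_range_truncate {M : Type*} [CommMonoid M] {n N : ℕ} (h : n ≤ N) (f : ℕ → M) :
    ∏ i ∈ Finset.range N, (if i < n then f i else 1) = ∏ i ∈ Finset.range n, f i := by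
  rw [← Finset.prod_filter]
  congr 1
  ext i
  simp only [Finset.mem_filter, Finset.mem_range]
  omega

/-- Padding with the constant $1$, whose matrix is $m$, brings two cylinder functions to a common
length before they are compared. -/
lemma elemFun_truncate (p : PMF Site) {n N : ℕ} (h : n ≤ N) (f : ℕ → Site → ℂ) :
    elemFun p N (fun i z => if i < n then f i z else 1) = elemFun p n f :=
  Lp.ext <| ((coeFn_elemFun _ _ _).trans
    (Eventually.of_forall fun x => prod_range_truncate h fun i => f i (x i))).trans
      (coeFn_elemFun _ _ _).symm

lemma elemFunTensor_truncate (p : PMF Site) {n N : ℕ} (h : n ≤ N) (f : ℕ → Site → ℂ) :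
    elemFunTensor p N (fun i z => if i < n then f i z else 1) = elemFunTensor p n f := by
  refine ElemTensor.ext fun i => ?_
  simp only [elemFunTensor]
  by_cases h₁ : i < n
  · simp [h₁, h₁.trans_le h]
  · simp only [h₁, if_false]
    exact ite_self _

lemma inner_elemFun (n n' : ℕ) (f f' : ℕ → Site → ℂ) :
    inner ℂ (elemFun p n f) (elemFun p n' f')
      = elemInner (elemFunTensor p n f) (elemFunTensor p n' f') := by
  rw [← elemFun_truncate p (le_max_left n n'), ← elemFun_truncate p (le_max_right n n') f',
    ← elemFunTensor_truncate p (le_max_left n n'), ← elemFunTensor_truncate p (le_max_right n n') f']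
  generalize (fun i z => if i < n then f i z else 1) = g
  generalize (fun i z => if i < n' then f' i z else 1) = g'
  generalize max n n' = N
  rw [L2.inner_def, elemInner_eq_prod _ _ N (fun i hi => by simp [elemFunTensor, not_lt.2 hi])
    (fun i hi => by simp [elemFunTensor, not_lt.2 hi])]
  have h : (fun x => inner ℂ (elemFun p N g x) (elemFun p N g' x)) =ᵐ[prodMeasure p]
      fun x => ∏ i ∈ Finset.range N, ((starRingEnd ℂ) (g i (x i)) * g' i (x i)) := by
    filter_upwards [coeFn_elemFun p N g, coeFn_elemFun p N g'] with x h₁ h₂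
    rw [h₁, h₂, RCLike.inner_apply, map_prod, mul_comm, Finset.prod_mul_distrib]
  rw [integral_congr_ae h,
    integral_prod_sites p N fun i z => (starRingEnd ℂ) (g i z) * g' i z]
  refine Finset.prod_congr rfl fun i hi => ?_
  rw [← hs_siteMatrix]
  simp [elemFunTensor, Finset.mem_range.1 hi, hs]

lemma elemFun_congr {n n' : ℕ} {f f' : ℕ → Site → ℂ}
    (h : elemFunTensor p n f = elemFunTensor p n' f') : elemFun p n f = elemFun p n' f' := by
  rw [← sub_eq_zero, ← inner_self_eq_zero (𝕜 := ℂ)]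
  simp only [inner_sub_left, inner_sub_right, inner_elemFun, h]
  ring

/-- The functions whose matrices are the factors of `a`. -/
def ElemTensor.funs (a : ElemTensor p) (i : ℕ) (z : Site) : ℂ :=
  a.toFun i z.1 z.2 / (Real.sqrt (p z).toReal : ℂ)

lemma sqrt_ne_zero (hp : ∀ z, p z ≠ 0) (z : Site) : (Real.sqrt (p z).toReal : ℂ) ≠ 0 := by
  rw [Complex.ofReal_ne_zero, Real.sqrt_ne_zero ENNReal.toReal_nonneg]
  exact (ENNReal.toReal_pos (hp z) (p.apply_ne_top z)).ne'

lemma elemFunTensor_funs (hp : ∀ z, p z ≠ 0) (a : ElemTensor p) {N : ℕ}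
    (hN : ∀ i, N ≤ i → a.toFun i = refMatrix p) : elemFunTensor p N a.funs = a := by
  refine ElemTensor.ext fun i => ?_
  by_cases h : i < N
  · ext k l
    simp [elemFunTensor, h, siteMatrix, ElemTensor.funs, div_mul_cancel₀ _ (sqrt_ne_zero hp _)]
  · simp [elemFunTensor, h, hN i (not_lt.1 h)]

/-- A function orthogonal to all product functions has integral zero over every box with finitely
many constrained coordinates. Boxes form a generating $\pi$-system, so its integral over every
measurable set is zero and it vanishes. -/
lemma dense_span_elemFun (p : PMF Site) :
    (Submodule.span ℂ (Set.range fun q : ℕ × (ℕ → Site → ℂ) =>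
      elemFun p q.1 q.2)).topologicalClosure = ⊤ := by
  rw [Submodule.topologicalClosure_eq_top_iff, Submodule.eq_bot_iff]
  intro g hg
  have hint : Integrable g (prodMeasure p) :=
    (Lp.memLp g).integrable (by norm_num)
  have hbox : ∀ (s : Finset ℕ) (t : ℕ → Set Site),
      ∫ x in (s : Set ℕ).pi t, g x ∂prodMeasure p = 0 := by
    classical
    intro s t
    obtain ⟨N, hN⟩ := s.exists_nat_subset_range
    -- The product of these factors is the indicator of the box; the implication makes unconstrained
    -- factors equal to $1$.
    let f : ℕ → Site → ℂ := fun i z => if i ∈ s → z ∈ t i then 1 else 0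
    have h0 : inner ℂ (elemFun p N f) g = 0 :=
      hg _ (Submodule.subset_span ⟨(N, f), rfl⟩)
    rw [L2.inner_def] at h0
    rw [← integral_indicator (MeasurableSet.pi s.countable_toSet fun i _ =>
      (Set.toFinite (t i)).measurableSet), ← h0]
    refine integral_congr_ae ?_
    filter_upwards [coeFn_elemFun p N f] with x hx
    rw [hx, RCLike.inner_apply]
    by_cases hm : x ∈ (s : Set ℕ).pi t
    · rw [Set.indicator_of_mem hm, Finset.prod_eq_one (f := fun i => f i (x i))
        fun i _ => if_pos fun hi => hm i hi]
      simp
    · rw [Set.indicator_of_notMem hm]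
      obtain ⟨i, hi, hit⟩ : ∃ i ∈ s, x i ∉ t i := by
        simpa [Set.mem_pi] using hm
      rw [Finset.prod_eq_zero (hN hi) (if_neg fun h => hit (h hi))]
      simp
  have hall : ∀ A : Set (ℕ → Site), MeasurableSet A → ∫ x in A, g x ∂prodMeasure p = 0 := by
    refine MeasurableSpace.induction_on_inter
      (C := fun A _ => ∫ x in A, g x ∂prodMeasure p = 0) generateFrom_squareCylinders.symm
      (isPiSystem_squareCylinders (fun _ => MeasurableSpace.isPiSystem_measurableSet) (by simp))
      ?_ ?_ ?_ ?_
    · simp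
    · rintro _ ⟨s, t, -, rfl⟩
      exact hbox s t
    · intro A hA h
      have h1 := integral_add_compl hA hint
      have h2 := hbox ∅ fun _ => Set.univ
      simp only [Finset.coe_empty, Set.empty_pi, setIntegral_univ] at h2
      rwa [h, zero_add, h2] at h1
    · intro A hd hm h
      rw [integral_iUnion hm hd hint.integrableOn]
      simp [h]
  exact (Lp.eq_zero_iff_ae_eq_zero).2
    (hint.ae_eq_zero_of_forall_setIntegral_eq_zero fun A hA _ => hall A hA)

/-- The identification `𝔍` exists. -/
lemma exists_isTensorId (hp : ∀ z, p z ≠ 0) : ∃ J : L2X p ≃ₗᵢ[ℂ] TensorH p, IsTensorId p J := by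
  have hN : ∀ a : ElemTensor p, ∃ N, ∀ i, N ≤ i → a.toFun i = refMatrix p := fun a =>
    eventually_atTop.1 a.eventually_ref
  choose N hN using hN
  -- The isometry is built in the direction $\mathfrak H\to L^2$, where prescribing it on elementary
  -- tensors suffices; $\mathfrak J$ is its inverse. Dividing by $\sqrt{p_{kl}}$ in `funs` is where
  -- positivity enters.
  obtain ⟨V, hV⟩ := exists_isometry_of_inner (p := p) (fun a => elemFun p (N a) a.funs)
    fun a b => by
      rw [inner_elemFun, elemFunTensor_funs hp a (hN a), elemFunTensor_funs hp b (hN b)]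
  have hV' : ∀ n f, V (tensor (elemFunTensor p n f)) = elemFun p n f := fun n f => by
    rw [hV]
    exact elemFun_congr (elemFunTensor_funs hp _ (hN _))
  have hsurj : Function.Surjective V := by
    rw [← LinearIsometry.coe_toLinearMap, ← LinearMap.range_eq_top, ← top_le_iff,
      ← dense_span_elemFun p]
    refine Submodule.topologicalClosure_minimal _ (Submodule.span_le.2 ?_)
      V.isometry.isClosedEmbedding.isClosed_range
    rintro _ ⟨q, rfl⟩
    exact ⟨_, hV' q.1 q.2⟩
  refine ⟨(LinearIsometryEquiv.ofSurjective V hsurj).symm, fun n f => ?_⟩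
  rw [LinearIsometryEquiv.symm_apply_eq]
  exact (hV' n f).symm

/-! ### The Radon-Nikodym derivative -/

@[simp] lemma actX_one (x : ℕ → Site) : actX 1 1 x = x := rfl

lemma actX_actX (s₀ s₁ t₀ t₁ : FinPerm) (x : ℕ → Site) :
    actX s₀ s₁ (actX t₀ t₁ x) = actX (t₀ * s₀) (t₁ * s₁) x := rfl

lemma measurable_actX (s₀ s₁ : FinPerm) : Measurable (actX s₀ s₁) := by
  refine measurable_pi_lambda _ fun i => ?_
  exact Measurable.prodMk (measurable_fst.comp (measurable_pi_apply _))
    (measurable_snd.comp (measurable_pi_apply _))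

lemma exists_finset_fixed (s₀ s₁ : FinPerm) (J : Finset ℕ) :
    ∃ I : Finset ℕ, J ⊆ I ∧ ∀ i, i ∉ I → s₀.1 i = i ∧ s₁.1 i = i := by
  classical
  have h₀ : {i | s₀.1 i ≠ i}.Finite := s₀.2
  have h₁ : {i | s₁.1 i ≠ i}.Finite := s₁.2
  refine ⟨J ∪ (h₀.toFinset ∪ h₁.toFinset), Finset.subset_union_left, fun i hi => ?_⟩
  simpa using (not_or.1 (mt Finset.mem_union.2 hi)).2

/-- The density `∏_i p((𝔞x)_i) / p(x_i)`. -/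
def density (p : PMF Site) (s₀ s₁ : FinPerm) (x : ℕ → Site) : ENNReal :=
  ∏ᶠ i, p (actX s₀ s₁ x i) / p (x i)

lemma density_eq_prod (hp : ∀ z, p z ≠ 0) {s₀ s₁ : FinPerm} {I : Finset ℕ}
    (hI : ∀ i, i ∉ I → s₀.1 i = i ∧ s₁.1 i = i) (x : ℕ → Site) :
    density p s₀ s₁ x = ∏ i ∈ I, p (actX s₀ s₁ x i) / p (x i) := by
  refine finprod_eq_prod_of_mulSupport_subset _ fun i hi => ?_
  by_contra h
  refine hi ?_
  simp only [actX, (hI i h).1, (hI i h).2, Prod.mk.eta]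
  exact ENNReal.div_self (hp _) (p.apply_ne_top _)

lemma density_ne_top (hp : ∀ z, p z ≠ 0) (s₀ s₁ : FinPerm) (x : ℕ → Site) :
    density p s₀ s₁ x ≠ ⊤ := by
  obtain ⟨I, -, hI⟩ := exists_finset_fixed s₀ s₁ ∅
  rw [density_eq_prod hp hI]
  exact ENNReal.prod_ne_top fun i _ => ENNReal.div_ne_top (p.apply_ne_top _) (hp _)

lemma density_ne_zero (hp : ∀ z, p z ≠ 0) (s₀ s₁ : FinPerm) (x : ℕ → Site) :
    density p s₀ s₁ x ≠ 0 := by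
  obtain ⟨I, -, hI⟩ := exists_finset_fixed s₀ s₁ ∅
  rw [density_eq_prod hp hI]
  exact Finset.prod_ne_zero_iff.2 fun i _ => ENNReal.div_ne_zero.2 ⟨hp _, p.apply_ne_top _⟩

lemma measurable_density (hp : ∀ z, p z ≠ 0) (s₀ s₁ : FinPerm) :
    Measurable (density p s₀ s₁) := by
  obtain ⟨I, -, hI⟩ := exists_finset_fixed s₀ s₁ ∅
  rw [show density p s₀ s₁ = _ from funext (density_eq_prod hp hI)]
  refine Finset.measurable_fun_prod _ fun i _ => Measurable.div ?_ (measurable_site_comp _ i)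
  exact (measurable_site_comp (fun z => p z) i).comp (measurable_actX s₀ s₁)

/-- The chain rule: factor by factor the intermediate weight $p((\mathfrak a_s x)_i)$ cancels. This
cocycle identity is what makes $\pi_\mu$ multiplicative. -/
lemma density_mul (hp : ∀ z, p z ≠ 0) (s₀ s₁ t₀ t₁ : FinPerm) (x : ℕ → Site) :
    density p s₀ s₁ x * density p t₀ t₁ (actX s₀ s₁ x) = density p (s₀ * t₀) (s₁ * t₁) x := by
  obtain ⟨I, -, hI⟩ := exists_finset_fixed s₀ s₁ ∅
  obtain ⟨J, hJ, hJ'⟩ := exists_finset_fixed t₀ t₁ I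
  have hI' : ∀ i, i ∉ J → s₀.1 i = i ∧ s₁.1 i = i := fun i hi => hI i fun h => hi (hJ h)
  rw [density_eq_prod hp hI', density_eq_prod hp hJ', density_eq_prod (I := J) hp fun i hi => by
      simp [hI' i hi, hJ' i hi], ← Finset.prod_mul_distrib]
  refine Finset.prod_congr rfl fun i _ => ?_
  rw [actX_actX, mul_comm, ← mul_div_assoc, ENNReal.div_mul_cancel (hp _) (p.apply_ne_top _)]

/-- The extension of a finite configuration by a constant. -/
def extendX (I : Finset ℕ) (K : I → Site) (i : ℕ) : Site :=
  if h : i ∈ I then K ⟨i, h⟩ else (0, 0)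

lemma extendX_apply {I : Finset ℕ} (K : I → Site) (i : I) : extendX I K i = K i := by
  simp [extendX]

lemma lintegral_prodMeasure_of_dependsOn (p : PMF Site) (I : Finset ℕ)
    (f : (ℕ → Site) → ENNReal) (hf : ∀ x y, (∀ i ∈ I, x i = y i) → f x = f y) :
    ∫⁻ x, f x ∂prodMeasure p = ∑ K : I → Site, f (extendX I K) * ∏ i : I, p (K i) := by
  have h := lintegral_restrict_infinitePi (μ := fun _ : ℕ => p.toMeasure)
    (s := I) (f := fun y => f (extendX I y)) (measurable_of_finite _)
  have h' : ∀ x : ℕ → Site, f (extendX I (I.restrict x)) = f x := fun x =>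
    hf _ _ fun i hi => by simp [extendX, hi]
  simp only [h'] at h
  rw [prodMeasure, h, lintegral_fintype]
  refine Finset.sum_congr rfl fun K _ => ?_
  rw [Measure.pi_singleton]
  simp only [PMF.toMeasure_apply_singleton _ _ (measurableSet_singleton _)]

lemma apply_mem_of_fixed {s : Equiv.Perm ℕ} {I : Finset ℕ} (h : ∀ i, i ∉ I → s i = i) {i : ℕ}
    (hi : i ∈ I) : s i ∈ I := by
  by_contra h'
  rw [s.injective (h _ h')] at h'
  exact h' hi

/-- Only a finite set $I$ of sites stable under both permutations matters. There the integrals are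
finite sums, $\mathfrak a$ permutes the configurations, and the density converts the weight of $K$
into that of its image. -/
lemma lintegral_comp_actX (hp : ∀ z, p z ≠ 0) (s₀ s₁ : FinPerm) (J : Finset ℕ)
    (f : (ℕ → Site) → ENNReal) (hf : ∀ x y, (∀ i ∈ J, x i = y i) → f x = f y) :
    ∫⁻ x, density p s₀ s₁ x * f (actX s₀ s₁ x) ∂prodMeasure p = ∫⁻ x, f x ∂prodMeasure p := by
  obtain ⟨I, hJI, hI⟩ := exists_finset_fixed s₀ s₁ J
  have hI₀ : ∀ i ∈ I, s₀.1 i ∈ I := fun i => apply_mem_of_fixed fun j hj => (hI j hj).1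
  have hI₁ : ∀ i ∈ I, s₁.1 i ∈ I := fun i => apply_mem_of_fixed fun j hj => (hI j hj).2
  have hact : ∀ x y : ℕ → Site, (∀ i ∈ I, x i = y i) →
      ∀ i ∈ I, actX s₀ s₁ x i = actX s₀ s₁ y i := fun x y h i hi => by
    simp only [actX, h _ (hI₀ i hi), h _ (hI₁ i hi)]
  rw [lintegral_prodMeasure_of_dependsOn p I f fun x y h => hf x y fun i hi => h i (hJI hi),
    lintegral_prodMeasure_of_dependsOn p I]
  swap
  · intro x y h
    rw [hf _ _ fun i hi => hact x y h i (hJI hi), density_eq_prod hp hI, density_eq_prod hp hI]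
    congr 1
    exact Finset.prod_congr rfl fun i hi => by rw [hact x y h i hi, h i hi]
  have hinv : ∀ (s : FinPerm), (∀ i, i ∉ I → s.1 i = i) → ∀ i, i ∉ I → (s⁻¹).1 i = i :=
    fun s hs i hi => by
      change (s.1)⁻¹ i = i
      rw [Equiv.Perm.inv_eq_iff_eq, hs i hi]
  -- Permutations fixing the complement of $I$ leave the default value $(0,0)$ in place there, so
  -- restricting to $I$ and extending again loses nothing.
  have hext : ∀ t₀ t₁ : FinPerm, (∀ i, i ∉ I → t₀.1 i = i) → (∀ i, i ∉ I → t₁.1 i = i) →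
      ∀ K : I → Site, extendX I (I.restrict (actX t₀ t₁ (extendX I K)))
        = actX t₀ t₁ (extendX I K) := fun t₀ t₁ h₀ h₁ K => by
    funext i
    by_cases hi : i ∈ I
    · simp [extendX, hi]
    · simp [extendX, hi, actX, h₀, h₁]
  have hres : ∀ K : I → Site, I.restrict (extendX I K) = K := fun K =>
    funext fun i => extendX_apply K i
  have h₀ := fun i hi => (hI i hi).1
  have h₁ := fun i hi => (hI i hi).2
  let e : (I → Site) ≃ (I → Site) :=
    { toFun := fun K => I.restrict (actX s₀ s₁ (extendX I K))
      invFun := fun K => I.restrict (actX s₀⁻¹ s₁⁻¹ (extendX I K))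
      left_inv := fun K => by
        beta_reduce
        rw [hext s₀ s₁ h₀ h₁, actX_actX, mul_inv_cancel, mul_inv_cancel, actX_one, hres]
      right_inv := fun K => by
        beta_reduce
        rw [hext _ _ (hinv s₀ h₀) (hinv s₁ h₁), actX_actX, inv_mul_cancel, inv_mul_cancel,
          actX_one, hres] }
  refine Fintype.sum_equiv e _ _ fun K => ?_
  have hw : density p s₀ s₁ (extendX I K) * ∏ i : I, p (K i) = ∏ i : I, p (e K i) := by
    rw [density_eq_prod hp hI, ← Finset.prod_coe_sort, ← Finset.prod_mul_distrib]
    refine Finset.prod_congr rfl fun i _ => ?_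
    rw [extendX_apply, ENNReal.div_mul_cancel (hp _) (p.apply_ne_top _)]
    rfl
  rw [mul_right_comm, hw, mul_comm]
  congr 2
  exact (hext s₀ s₁ h₀ h₁ K).symm

lemma map_withDensity_density (hp : ∀ z, p z ≠ 0) (s₀ s₁ : FinPerm) :
    ((prodMeasure p).withDensity (density p s₀ s₁)).map (actX s₀ s₁) = prodMeasure p := by
  refine Measure.eq_infinitePi _ fun s t ht => ?_
  have hm : MeasurableSet ((s : Set ℕ).pi t) :=
    MeasurableSet.pi s.countable_toSet fun i _ => ht i
  rw [Measure.map_apply (measurable_actX _ _) hm, withDensity_apply _ (measurable_actX _ _ hm),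
    ← Measure.infinitePi_pi (fun _ : ℕ => p.toMeasure) fun i _ => ht i,
    ← lintegral_indicator (measurable_actX _ _ hm), ← lintegral_indicator_one hm]
  refine Eq.trans ?_ (lintegral_comp_actX hp s₀ s₁ s (((s : Set ℕ).pi t).indicator 1) ?_)
  · refine lintegral_congr fun x => ?_
    by_cases h : actX s₀ s₁ x ∈ (s : Set ℕ).pi t
    · rw [Set.indicator_of_mem h, Set.indicator_of_mem (Set.mem_preimage.2 h), Pi.one_apply,
        mul_one]
    · rw [Set.indicator_of_notMem h, Set.indicator_of_notMem (mt Set.mem_preimage.1 h), mul_zero]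
  · intro x y h
    have : x ∈ (s : Set ℕ).pi t ↔ y ∈ (s : Set ℕ).pi t :=
      forall₂_congr fun i hi => by rw [h i hi]
    by_cases hx : x ∈ (s : Set ℕ).pi t
    · rw [Set.indicator_of_mem hx, Set.indicator_of_mem (this.1 hx)]
      rfl
    · rw [Set.indicator_of_notMem hx, Set.indicator_of_notMem (mt this.2 hx)]

/-- Pushing `map_withDensity_density` forward by $\mathfrak a^{-1}$ exhibits the image of $\mu$
under $\mathfrak a^{-1}$ as $\mu$ with this density. -/
lemma rnX_eq_density (hp : ∀ z, p z ≠ 0) (s₀ s₁ : FinPerm) :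
    rnX p s₀ s₁ =ᵐ[prodMeasure p] fun x => (density p s₀ s₁ x).toReal := by
  have h : (prodMeasure p).map (actX s₀⁻¹ s₁⁻¹)
      = (prodMeasure p).withDensity (density p s₀ s₁) := by
    conv_lhs => rw [← map_withDensity_density hp s₀ s₁]
    rw [Measure.map_map (measurable_actX _ _) (measurable_actX _ _)]
    convert Measure.map_id
    funext x
    simp [actX_actX]
  have h' := Measure.rnDeriv_withDensity (prodMeasure p) (measurable_density hp s₀ s₁)
  filter_upwards [h'] with x hx
  rw [rnX, h, hx]

/-! ### Weighted composition operators -/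

lemma quasiMeasurePreserving_of_density {X : Type*} [MeasurableSpace X] {μ : Measure X}
    {a : X → X} {r : X → ENNReal} (ha : Measurable a) (hr : Measurable r) (h0 : ∀ x, r x ≠ 0)
    (h : (μ.withDensity r).map a = μ) : Measure.QuasiMeasurePreserving a μ μ := by
  refine ⟨ha, ?_⟩
  refine Measure.AbsolutelyContinuous.trans
    (Measure.AbsolutelyContinuous.map (withDensity_absolutelyContinuous' hr.aemeasurable
      (Eventually.of_forall h0)) ha) ?_
  rw [h]

/-- The hypothesis on the image measure is the change of variables that preserves the $L^2$ norm.
Since $c$ never vanishes, $a$ is also quasi-measure-preserving, so almost everywhere identities may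
be composed with $a$. -/
lemma exists_weightedComp {X : Type*} [MeasurableSpace X] {μ : Measure X}
    {a : X → X} {c : X → ℂ} (ha : Measurable a) (hc : Measurable c) (h0 : ∀ x, c x ≠ 0)
    (h : (μ.withDensity fun x => ‖c x‖ₑ ^ 2).map a = μ) :
    ∃ W : Lp ℂ 2 μ →ₗᵢ[ℂ] Lp ℂ 2 μ,
      ∀ ζ : Lp ℂ 2 μ, (W ζ : X → ℂ) =ᵐ[μ] fun x => c x * ζ (a x) := by
  have hm : Measurable fun x => ‖c x‖ₑ ^ 2 := hc.enorm.pow_const 2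
  have hq := quasiMeasurePreserving_of_density ha hm (fun x => by simp [h0]) h
  have hnorm : ∀ ζ : Lp ℂ 2 μ, eLpNorm (fun x => c x * ζ (a x)) 2 μ = eLpNorm ζ 2 μ := by
    intro ζ
    have hζ : Measurable fun x => ‖ζ x‖ₑ ^ 2 :=
      ((Lp.stronglyMeasurable ζ).measurable.enorm).pow_const 2
    rw [eLpNorm_eq_lintegral_rpow_enorm_toReal (by norm_num) (by norm_num),
      eLpNorm_eq_lintegral_rpow_enorm_toReal (by norm_num) (by norm_num)]
    congr 1
    simp only [ENNReal.toReal_ofNat, ENNReal.rpow_ofNat]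
    refine Eq.trans ?_ (congrArg (fun ν => ∫⁻ x, ‖(ζ : X → ℂ) x‖ₑ ^ 2 ∂ν) h)
    rw [lintegral_map hζ ha]
    refine Eq.trans ?_ (lintegral_withDensity_eq_lintegral_mul _ hm (hζ.comp ha)).symm
    refine lintegral_congr fun x => ?_
    rw [enorm_mul, mul_pow]
    rfl
  have hmem : ∀ ζ : Lp ℂ 2 μ, MemLp (fun x => c x * ζ (a x)) 2 μ := fun ζ =>
    ⟨hc.aestronglyMeasurable.mul
      ((Lp.stronglyMeasurable ζ).comp_measurable ha).aestronglyMeasurable,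
      (hnorm ζ).trans_lt (Lp.eLpNorm_lt_top ζ)⟩
  refine ⟨⟨⟨⟨fun ζ => (hmem ζ).toLp _, fun ζ η => ?_⟩, fun r ζ => ?_⟩, fun ζ => ?_⟩,
    fun ζ => (hmem ζ).coeFn_toLp⟩
  · refine Lp.ext ?_
    filter_upwards [(hmem (ζ + η)).coeFn_toLp, (hmem ζ).coeFn_toLp, (hmem η).coeFn_toLp,
      Lp.coeFn_add ((hmem ζ).toLp _) ((hmem η).toLp _), 
      hq.ae (Lp.coeFn_add ζ η)] with x h₁ h₂ h₃ h₄ h₅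
    rw [h₁, h₄, Pi.add_apply, h₂, h₃, h₅, Pi.add_apply, mul_add]
  · refine Lp.ext ?_
    filter_upwards [(hmem (r • ζ)).coeFn_toLp, (hmem ζ).coeFn_toLp,
      Lp.coeFn_smul r ((hmem ζ).toLp _), hq.ae (Lp.coeFn_smul r ζ)] with x h₁ h₂ h₃ h₄
    rw [RingHom.id_apply]
    rw [h₁, h₃, Pi.smul_apply, h₂, h₄, Pi.smul_apply, smul_eq_mul, smul_eq_mul]
    ring
  · change ‖(hmem ζ).toLp _‖ = ‖ζ‖
    rw [Lp.norm_toLp, hnorm, Lp.norm_def]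

/-! ### Existence of the representation -/

/-- The character `γ ↦ (-1)^{∑_i γ_i n_i}`. -/
def signChar (n : ℕ → ℕ) (γ : ℕ →₀ ZMod 2) : ℂ := γ.prod fun i g => (-1 : ℂ) ^ (g.val * n i)

lemma signChar_add (n : ℕ → ℕ) (γ δ : ℕ →₀ ZMod 2) :
    signChar n (γ + δ) = signChar n γ * signChar n δ := by
  refine Finsupp.prod_add_index' (fun i => by simp) fun i g h => ?_
  simp only [pow_mul]
  rw [← mul_pow]
  congr 1
  -- Representatives add only modulo $2$, which is all that a sign depends on.
  have hpar : ∀ g h : ZMod 2, (g + h).val % 2 = (g.val + h.val) % 2 := by decide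
  rw [← pow_add]
  exact neg_one_pow_congr (by simp only [Nat.even_iff, hpar])

lemma signChar_permAction (n : ℕ → ℕ) (s : FinPerm) (γ : GammaInf) :
    signChar n (permAction s γ).toAdd = signChar (fun i => n (s.1 i)) γ.toAdd := by
  exact Finsupp.prod_equivMapDomain _ _ _

lemma signExp_eq (γ₀ γ₁ : ℕ →₀ ZMod 2) (x : ℕ → Site) :
    (-1 : ℂ) ^ signExp γ₀ γ₁ x
      = signChar (fun i => ((x i).1 : ℕ)) γ₀ * signChar (fun i => ((x i).2 : ℕ)) γ₁ := by
  rw [signExp, pow_add, ← Finset.prod_pow_eq_pow_sum, ← Finset.prod_pow_eq_pow_sum]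
  rfl

/-- The multiplier of `π_μ(g)`. -/
def multiplier (p : PMF Site) (g : Wreath × Wreath) (x : ℕ → Site) : ℂ :=
  (-1) ^ signExp g.1.left.toAdd g.2.left.toAdd x *
    (Real.sqrt (density p g.1.right g.2.right x).toReal : ℂ)

/-- Signs and square roots of densities are cocycles together: the twist of the semidirect product
on $\gamma$ matches the evaluation of the sign at the moved point. -/
lemma multiplier_mul (hp : ∀ z, p z ≠ 0) (g h : Wreath × Wreath) (x : ℕ → Site) :
    multiplier p (g * h) x
      = multiplier p g x * multiplier p h (actX g.1.right g.2.right x) := by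
  simp only [multiplier, Prod.fst_mul, Prod.snd_mul, SemidirectProduct.mul_left,
    SemidirectProduct.mul_right, signExp_eq, toAdd_mul, signChar_add, signChar_permAction]
  rw [← density_mul hp, ENNReal.toReal_mul, Real.sqrt_mul ENNReal.toReal_nonneg,
    Complex.ofReal_mul]
  simp only [actX]
  ring

lemma multiplier_ne_zero (hp : ∀ z, p z ≠ 0) (g : Wreath × Wreath) (x : ℕ → Site) :
    multiplier p g x ≠ 0 := by
  refine mul_ne_zero (pow_ne_zero _ (by norm_num)) ?_
  rw [Complex.ofReal_ne_zero, Real.sqrt_ne_zero ENNReal.toReal_nonneg]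
  exact (ENNReal.toReal_pos (density_ne_zero hp _ _ _) (density_ne_top hp _ _ _)).ne'

lemma measurable_multiplier (hp : ∀ z, p z ≠ 0) (g : Wreath × Wreath) :
    Measurable (multiplier p g) := by
  refine Measurable.mul ?_ ?_
  · refine (measurable_of_countable fun n : ℕ => (-1 : ℂ) ^ n).comp ?_
    refine Measurable.add ?_ ?_ <;> refine Finset.measurable_fun_sum _ fun i _ => ?_
    · exact measurable_site_comp (fun z => (g.1.left.toAdd i).val * (z.1 : ℕ)) i
    · exact measurable_site_comp (fun z => (g.2.left.toAdd i).val * (z.2 : ℕ)) i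
  · exact Complex.measurable_ofReal.comp
      (Real.continuous_sqrt.measurable.comp (measurable_density hp _ _).ennreal_toReal)

lemma enorm_multiplier_sq (hp : ∀ z, p z ≠ 0) (g : Wreath × Wreath) (x : ℕ → Site) :
    ‖multiplier p g x‖ₑ ^ 2 = density p g.1.right g.2.right x := by
  have h : ‖multiplier p g x‖ = Real.sqrt (density p g.1.right g.2.right x).toReal := by
    rw [multiplier, norm_mul, norm_pow, norm_neg, norm_one, one_pow, one_mul, Complex.norm_real,
      Real.norm_of_nonneg (Real.sqrt_nonneg _)]
  rw [← ofReal_norm, h, ← ENNReal.ofReal_pow (Real.sqrt_nonneg _),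
    Real.sq_sqrt ENNReal.toReal_nonneg, ENNReal.ofReal_toReal (density_ne_top hp _ _ _)]

/-- The representation `π_μ` exists. -/
lemma exists_isRepMu (hp : ∀ z, p z ≠ 0) :
    ∃ π : Wreath × Wreath →* unitary (L2X p →L[ℂ] L2X p), IsRepMu p π := by
  have hmap : ∀ g : Wreath × Wreath,
      ((prodMeasure p).withDensity fun x => ‖multiplier p g x‖ₑ ^ 2).map
        (actX g.1.right g.2.right) = prodMeasure p := fun g => by
    simp only [enorm_multiplier_sq hp]
    exact map_withDensity_density hp _ _
  have hW := fun g => exists_weightedComp (measurable_actX g.1.right g.2.right)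
    (measurable_multiplier hp g) (multiplier_ne_zero hp g) (hmap g)
  choose W hW using hW
  have hq : ∀ g : Wreath × Wreath, Measure.QuasiMeasurePreserving (actX g.1.right g.2.right)
      (prodMeasure p) (prodMeasure p) := fun g =>
    quasiMeasurePreserving_of_density (measurable_actX _ _) (measurable_density hp _ _)
      (density_ne_zero hp _ _) (map_withDensity_density hp _ _)
  have hmul : ∀ g h ζ, W (g * h) ζ = W g (W h ζ) := fun g h ζ => by
    refine Lp.ext ?_
    filter_upwards [hW (g * h) ζ, hW g (W h ζ), (hq g).ae (hW h ζ)] with x h₁ h₂ h₃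
    rw [h₁, h₂, h₃, multiplier_mul hp, mul_assoc]
    rfl
  -- $W_1$ is an idempotent isometry, hence the identity.
  have hone : ∀ ζ, W 1 ζ = ζ := fun ζ => by
    refine (W 1).injective ?_
    rw [← hmul, one_mul]
  let U : Wreath × Wreath → (L2X p →L[ℂ] L2X p) := fun g => (W g).toContinuousLinearMap
  have hU : ∀ g h, U (g * h) = U g * U h := fun g h => ContinuousLinearMap.ext (hmul g h)
  have hU1 : U 1 = 1 := ContinuousLinearMap.ext hone
  have hstar : ∀ g, star (U g) * U g = 1 := fun g =>
    (ContinuousLinearMap.norm_map_iff_adjoint_comp_self (U g)).1 (W g).norm_map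
  have hstar' : ∀ g, star (U g) = U g⁻¹ := fun g => by
    calc star (U g) = star (U g) * (U g * U g⁻¹) := by rw [← hU, mul_inv_cancel, hU1, mul_one]
      _ = U g⁻¹ := by rw [← mul_assoc, hstar, one_mul]
  refine ⟨⟨⟨fun g => ⟨U g, Unitary.mem_iff.2 ⟨hstar g, ?_⟩⟩, Subtype.ext hU1⟩,
    fun g h => Subtype.ext (hU g h)⟩, fun s₀ s₁ ζ => ?_, fun γ₀ γ₁ ζ => ?_⟩
  · rw [hstar', ← hU, mul_inv_cancel, hU1]
  · filter_upwards [hW (permG s₀, permG s₁) ζ, rnX_eq_density hp s₀ s₁] with x h₁ h₂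
    refine h₁.trans ?_
    rw [h₂]
    simp [multiplier, permG, signExp]
  · filter_upwards [hW (gammaG γ₀, gammaG γ₁) ζ] with x h₁
    refine h₁.trans ?_
    have : density p 1 1 x = 1 := by
      rw [density_eq_prod (I := ∅) hp fun i _ => ⟨rfl, rfl⟩, Finset.prod_empty]
    simp [multiplier, gammaG, this]

lemma IsRepMu.perm_density (hp : ∀ z, p z ≠ 0)
    {π : Wreath × Wreath →* unitary (L2X p →L[ℂ] L2X p)} (hπ : IsRepMu p π)
    (s₀ s₁ : FinPerm) (ζ : L2X p) :
    ((π (permG s₀, permG s₁) : L2X p →L[ℂ] L2X p) ζ : (ℕ → Site) → ℂ) =ᵐ[prodMeasure p]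
      fun x => (Real.sqrt (density p s₀ s₁ x).toReal : ℂ) * ζ (actX s₀ s₁ x) := by
  filter_upwards [hπ.perm s₀ s₁ ζ, rnX_eq_density hp s₀ s₁] with x h₁ h₂
  rw [h₁, h₂]

lemma quasiMeasurePreserving_actX (hp : ∀ z, p z ≠ 0) (s₀ s₁ : FinPerm) :
    Measure.QuasiMeasurePreserving (actX s₀ s₁) (prodMeasure p) (prodMeasure p) :=
  quasiMeasurePreserving_of_density (measurable_actX _ _) (measurable_density hp _ _)
    (density_ne_zero hp _ _) (map_withDensity_density hp _ _)

/-! ### The representation in the tensor picture -/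

/-- The two embeddings `G → G × G`. -/
def sideEmb : Bool → Wreath →* Wreath × Wreath
  | false => MonoidHom.inl Wreath Wreath
  | true => MonoidHom.inr Wreath Wreath

/-- `(z, w) ↦ z` with the coordinate on the side `σ` replaced by that of `w`. -/
def exchange : Bool → Site → Site → Site
  | false, z, w => (w.1, z.2)
  | true, z, w => (z.1, w.2)

/-- The coordinate on the side `σ`. -/
def coord : Bool → Site → Fin 2
  | false => Prod.fst
  | true => Prod.snd

lemma permG_one : permG 1 = 1 := map_one _

lemma gammaG_zero : gammaG 0 = 1 := map_one _

/-- Action of a permutation on the coordinates of the side `σ`. -/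
def sideAct : Bool → FinPerm → (ℕ → Site) → ℕ → Site
  | false, s => actX s 1
  | true, s => actX 1 s

lemma sideAct_apply (σ : Bool) (s : FinPerm) (x : ℕ → Site) (i : ℕ) :
    sideAct σ s x i = exchange σ (x i) (x (s.1 i)) := by
  cases σ <;> rfl

lemma coeFn_symm_tensor (hp : ∀ z, p z ≠ 0) {J : L2X p ≃ₗᵢ[ℂ] TensorH p} (hJ : IsTensorId p J)
    (a : ElemTensor p) {N : ℕ} (hN : ∀ i, N ≤ i → a.toFun i = refMatrix p) :
    (J.symm (tensor a) : (ℕ → Site) → ℂ) =ᵐ[prodMeasure p]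
      fun x => ∏ i ∈ Finset.range N, a.funs i (x i) := by
  have h : J.symm (tensor a) = elemFun p N a.funs := by
    rw [LinearIsometryEquiv.symm_apply_eq, hJ, elemFunTensor_funs hp a hN]
  rw [h]
  exact coeFn_elemFun p N a.funs

/-- Entrywise form of the flip: $\sum_{i,j}E_{ij}\otimes E_{ji}$ swaps the row indices when acting
from the left, the column indices when acting from the right. -/
lemma sum_side_single (σ : Bool) (A B : M2) (z w : Site) :
    ∑ i : Fin 2, ∑ j : Fin 2, side σ (Matrix.single i j 1) A z.1 z.2 *
      side σ (Matrix.single j i 1) B w.1 w.2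
      = A (exchange σ z w).1 (exchange σ z w).2 * B (exchange σ w z).1 (exchange σ w z).2 := by
  obtain ⟨z₀, z₁⟩ := z
  obtain ⟨w₀, w₁⟩ := w
  cases σ <;> fin_cases z₀ <;> fin_cases z₁ <;> fin_cases w₀ <;> fin_cases w₁ <;>
    simp [exchange, Matrix.mul_apply, Matrix.single_apply]

lemma coeFn_sidePerm (hp : ∀ z, p z ≠ 0)
    {π : Wreath × Wreath →* unitary (L2X p →L[ℂ] L2X p)} (hπ : IsRepMu p π) (σ : Bool)
    (s : FinPerm) {I : Finset ℕ} (hI : ∀ i, i ∉ I → s.1 i = i) (ζ : L2X p) :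
    ((π (sideEmb σ (permG s)) : L2X p →L[ℂ] L2X p) ζ : (ℕ → Site) → ℂ) =ᵐ[prodMeasure p]
      fun x => (∏ i ∈ I, (Real.sqrt (p (sideAct σ s x i)).toReal : ℂ) /
        (Real.sqrt (p (x i)).toReal : ℂ)) * ζ (sideAct σ s x) := by
  have hd : ∀ s₀ s₁ : FinPerm, (∀ i, i ∉ I → s₀.1 i = i ∧ s₁.1 i = i) → ∀ x : ℕ → Site,
      (Real.sqrt (density p s₀ s₁ x).toReal : ℂ)
        = ∏ i ∈ I, (Real.sqrt (p (actX s₀ s₁ x i)).toReal : ℂ) /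
          (Real.sqrt (p (x i)).toReal : ℂ) := fun s₀ s₁ h x => by
    rw [density_eq_prod hp h, ENNReal.toReal_prod,
      Real.sqrt_prod I fun i _ => ENNReal.toReal_nonneg, Complex.ofReal_prod]
    refine Finset.prod_congr rfl fun i _ => ?_
    rw [ENNReal.toReal_div, Real.sqrt_div' _ ENNReal.toReal_nonneg, Complex.ofReal_div]
  cases σ
  · filter_upwards [hπ.perm_density hp s 1 ζ] with x hx
    rw [permG_one] at hx
    refine hx.trans ?_
    rw [hd s 1 (fun i hi => ⟨hI i hi, rfl⟩)]
    rfl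
  · filter_upwards [hπ.perm_density hp 1 s ζ] with x hx
    rw [permG_one] at hx
    refine hx.trans ?_
    rw [hd 1 s (fun i hi => ⟨rfl, hI i hi⟩)]
    rfl

lemma quasiMeasurePreserving_sideAct (hp : ∀ z, p z ≠ 0) (σ : Bool) (s : FinPerm) :
    Measure.QuasiMeasurePreserving (sideAct σ s) (prodMeasure p) (prodMeasure p) := by
  cases σ <;> exact quasiMeasurePreserving_actX hp _ _

/-- In the tensor picture a transposition is the exchange of two tensor factors of the algebra. -/
lemma conj_transp (hp : ∀ z, p z ≠ 0)
    {π : Wreath × Wreath →* unitary (L2X p →L[ℂ] L2X p)} (hπ : IsRepMu p π)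
    {J : L2X p ≃ₗᵢ[ℂ] TensorH p} (hJ : IsTensorId p J) (σ : Bool) {k l : ℕ} (hkl : k ≠ l) :
    J.conjStarAlgEquiv (π (sideEmb σ (permG (transp k l))))
      = ∑ i : Fin 2, ∑ j : Fin 2, siteOp k (side σ (Matrix.single i j 1)) *
          siteOp l (side σ (Matrix.single j i 1)) := by
  refine TensorH.clm_ext fun a => J.symm.injective ?_
  obtain ⟨N, hN⟩ := eventually_atTop.1
    (a.eventually_ref.and ((eventually_gt_atTop k).and (eventually_gt_atTop l)))
  have hkN : k < N := by
    by_contra h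
    exact lt_irrefl _ (hN k (by omega)).2.1
  have hlN : l < N := by
    by_contra h
    exact lt_irrefl _ (hN l (by omega)).2.2
  let b : Fin 2 × Fin 2 → ElemTensor p := fun q =>
    (a.update l (side σ (Matrix.single q.2 q.1 1) (a.toFun l))).update k
      (side σ (Matrix.single q.1 q.2 1) (a.toFun k))
  have hR : (∑ i : Fin 2, ∑ j : Fin 2, siteOp k (side σ (Matrix.single i j 1)) *
      siteOp l (side σ (Matrix.single j i 1)) :
      TensorH p →L[ℂ] TensorH p) (tensor a) = ∑ q, tensor (b q) := by
    rw [Fintype.sum_prod_type]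
    simp [siteOp_tensor, hkl, b]
  rw [hR, LinearIsometryEquiv.conjStarAlgEquiv_apply_apply, LinearIsometryEquiv.symm_apply_apply,
    map_sum]
  have hfix : ∀ i, i ∉ Finset.range N → (transp k l).1 i = i := fun i hi =>
    Equiv.swap_apply_of_ne_of_ne (by rintro rfl; simp [hkN] at hi) (by rintro rfl; simp [hlN] at hi)
  have hbN : ∀ q i, N ≤ i → (b q).toFun i = refMatrix p := fun q i hi => by
    rw [ElemTensor.update_of_ne _ (by omega), ElemTensor.update_of_ne _ (by omega), (hN i hi).1]
  refine Lp.ext ?_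
  have hb : ∀ᵐ x ∂prodMeasure p, ∀ q, J.symm (tensor (b q)) x
      = ∏ i ∈ Finset.range N, (b q).funs i (x i) :=
    ae_all_iff.2 fun q => coeFn_symm_tensor hp hJ (b q) (hbN q)
  filter_upwards [coeFn_sidePerm hp hπ σ (transp k l) hfix (J.symm (tensor a)),
    (quasiMeasurePreserving_sideAct hp σ (transp k l)).ae
      (coeFn_symm_tensor hp hJ a fun i hi => (hN i hi).1),
    Lp.coeFn_fun_finsetSum Finset.univ (fun q => J.symm (tensor (b q))), hb] with x h₁ h₂ h₃ h₄
  rw [h₁, h₂, h₃]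
  simp only [h₄, ElemTensor.funs, Finset.prod_div_distrib]
  -- The square roots at $\mathfrak a x$ coming from the density cancel against the denominators of
  -- the transported function; those at $x$ are common to both sides.
  rw [← Finset.sum_div, div_mul_div_comm, mul_comm, mul_div_mul_right _ _
    (Finset.prod_ne_zero_iff.2 fun i _ => sqrt_ne_zero hp _)]
  congr 1
  have hl : l ∈ (Finset.range N).erase k :=
    Finset.mem_erase.2 ⟨hkl.symm, Finset.mem_range.2 hlN⟩
  have split : ∀ f : ℕ → ℂ, ∏ i ∈ Finset.range N, f i
      = f k * f l * ∏ i ∈ ((Finset.range N).erase k).erase l, f i := fun f => by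
    rw [← Finset.mul_prod_erase _ f (Finset.mem_range.2 hkN), ← Finset.mul_prod_erase _ f hl,
      mul_assoc]
  simp only [split]
  have hrest : ∀ q, ∏ i ∈ ((Finset.range N).erase k).erase l, (b q).toFun i (x i).1 (x i).2
      = ∏ i ∈ ((Finset.range N).erase k).erase l,
        a.toFun i (sideAct σ (transp k l) x i).1 (sideAct σ (transp k l) x i).2 := fun q => by
    refine Finset.prod_congr rfl fun i hi => ?_
    have hil := Finset.ne_of_mem_erase hi
    have hik := Finset.ne_of_mem_erase (Finset.mem_of_mem_erase hi)
    rw [ElemTensor.update_of_ne _ hik, ElemTensor.update_of_ne _ hil, sideAct_apply,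
      show (transp k l).1 i = i from Equiv.swap_apply_of_ne_of_ne hik hil]
    cases σ <;> rfl
  simp only [hrest]
  rw [← Finset.sum_mul]
  congr 1
  simp only [sideAct_apply, show (transp k l).1 k = l from Equiv.swap_apply_left k l,
    show (transp k l).1 l = k from Equiv.swap_apply_right k l]
  rw [← sum_side_single, Fintype.sum_prod_type]
  simp [b, hkl.symm]

/-- The diagonal matrix `diag(1, (-1)^g)`. -/
def signMatrix (g : ZMod 2) : M2 := Matrix.diagonal fun j => (-1) ^ (g.val * (j : ℕ))

lemma side_signMatrix (σ : Bool) (g : ZMod 2) (A : M2) (z : Site) :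
    side σ (signMatrix g) A z.1 z.2 = (-1) ^ (g.val * (coord σ z : ℕ)) * A z.1 z.2 := by
  cases σ
  · simp [signMatrix, coord, Matrix.diagonal_mul]
  · simp [signMatrix, coord, Matrix.mul_diagonal, mul_comm]

lemma signMatrix_zero : signMatrix 0 = 1 := by simp [signMatrix]

/-- The local element of the sign characters. -/
def signElem (γ : ℕ →₀ ZMod 2) : LocalElem :=
  ⟨fun i => signMatrix (γ i), by
    obtain ⟨N, hN⟩ := γ.support.exists_nat_subset_range
    refine eventually_atTop.2 ⟨N, fun i hi => ?_⟩
    have : γ i = 0 := by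
      by_contra h
      have := Finset.mem_range.1 (hN (Finsupp.mem_support_iff.2 h))
      omega
    rw [this, signMatrix_zero]⟩

lemma conj_gamma (hp : ∀ z, p z ≠ 0)
    {π : Wreath × Wreath →* unitary (L2X p →L[ℂ] L2X p)} (hπ : IsRepMu p π)
    {J : L2X p ≃ₗᵢ[ℂ] TensorH p} (hJ : IsTensorId p J) (σ : Bool) (γ : ℕ →₀ ZMod 2) :
    IsSideMul σ (signElem γ) (J.conjStarAlgEquiv (π (sideEmb σ (gammaG γ)))) := fun a => by
  rw [LinearIsometryEquiv.conjStarAlgEquiv_apply_apply, ← LinearIsometryEquiv.eq_symm_apply]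
  obtain ⟨N, hN⟩ := eventually_atTop.1
    (a.eventually_ref.and ((signElem γ).sideMul σ a).eventually_ref)
  obtain ⟨N', hN'⟩ := γ.support.exists_nat_subset_range
  have hsub : γ.support ⊆ Finset.range (max N N') :=
    hN'.trans (Finset.range_subset_range.2 (le_max_right _ _))
  have hchar : ((π (sideEmb σ (gammaG γ)) : L2X p →L[ℂ] L2X p) (J.symm (tensor a)) :
      (ℕ → Site) → ℂ) =ᵐ[prodMeasure p]
      fun x => signChar (fun i => (coord σ (x i) : ℕ)) γ * J.symm (tensor a) x := by
    have hone : ∀ n, signChar n 0 = 1 := fun n => Finsupp.prod_zero_index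
    cases σ
    · filter_upwards [hπ.gamma γ 0 (J.symm (tensor a))] with x hx
      rw [gammaG_zero, signExp_eq, hone, mul_one] at hx
      exact hx
    · filter_upwards [hπ.gamma 0 γ (J.symm (tensor a))] with x hx
      rw [gammaG_zero, signExp_eq, hone, one_mul] at hx
      exact hx
  refine Lp.ext ?_
  filter_upwards [hchar,
    coeFn_symm_tensor hp hJ a fun i hi => (hN i (le_trans (le_max_left N N') hi)).1,
    coeFn_symm_tensor hp hJ ((signElem γ).sideMul σ a) fun i hi =>
      (hN i (le_trans (le_max_left N N') hi)).2] with x h₁ h₂ h₃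
  rw [h₁, h₂, h₃, signChar, Finsupp.prod_of_support_subset γ hsub _ (by simp),
    ← Finset.prod_mul_distrib]
  refine Finset.prod_congr rfl fun i _ => ?_
  simp only [ElemTensor.funs, LocalElem.sideMul, signElem, side_signMatrix]
  ring

/-! ### Averages -/

section Averages

variable {H : Type*} [NormedAddCommGroup H] [InnerProductSpace ℂ H]

lemma norm_sum_sq_of_orthogonal (y : ℕ → H) (h : ∀ k l, k ≠ l → inner ℂ (y k) (y l) = 0)
    (s : Finset ℕ) : ‖∑ l ∈ s, y l‖ ^ 2 = ∑ l ∈ s, ‖y l‖ ^ 2 := by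
  have key : (inner ℂ (∑ l ∈ s, y l) (∑ l ∈ s, y l) : ℂ) = ∑ l ∈ s, ((‖y l‖ : ℂ)) ^ 2 := by
    rw [sum_inner]
    refine Finset.sum_congr rfl fun k hk => ?_
    rw [inner_sum, Finset.sum_eq_single_of_mem k hk fun l _ hl => h k l hl.symm,
      inner_self_eq_norm_sq_to_K]
    rfl
  rw [inner_self_eq_norm_sq_to_K] at key
  refine Complex.ofReal_injective ?_
  push_cast
  exact key

/-- By Pythagoras the squared norm of the average is at most $C^2/n$. -/
lemma tendsto_average_of_orthogonal (y : ℕ → H) (C : ℝ)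
    (h : ∀ k l, k ≠ l → inner ℂ (y k) (y l) = 0) (hC : ∀ l, ‖y l‖ ≤ C) :
    Tendsto (fun n : ℕ => (n : ℂ)⁻¹ • ∑ l ∈ Finset.range n, y l) atTop (𝓝 0) := by
  have hsq : ∀ n : ℕ, ‖(n : ℂ)⁻¹ • ∑ l ∈ Finset.range n, y l‖ ^ 2 ≤ C ^ 2 * (n : ℝ)⁻¹ := by
    intro n
    rw [norm_smul, mul_pow, norm_sum_sq_of_orthogonal y h, norm_inv, Complex.norm_natCast]
    have : ∑ l ∈ Finset.range n, ‖y l‖ ^ 2 ≤ n * C ^ 2 := by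
      refine (Finset.sum_le_sum fun l _ =>
        pow_le_pow_left₀ (norm_nonneg _) (hC l) 2).trans_eq ?_
      simp
    rcases Nat.eq_zero_or_pos n with rfl | hn
    · simp
    · have hn' : (0 : ℝ) < n := Nat.cast_pos.2 hn
      calc ((n : ℝ)⁻¹) ^ 2 * ∑ l ∈ Finset.range n, ‖y l‖ ^ 2
          ≤ ((n : ℝ)⁻¹) ^ 2 * (n * C ^ 2) := by gcongr
        _ = C ^ 2 * (n : ℝ)⁻¹ := by field_simp
  have h0 : Tendsto (fun n : ℕ => C ^ 2 * (n : ℝ)⁻¹) atTop (𝓝 0) := by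
    simpa using tendsto_inv_atTop_nhds_zero_nat (𝕜 := ℝ) |>.const_mul (C ^ 2)
  have h1 := squeeze_zero (fun n => sq_nonneg _) hsq h0
  rw [tendsto_zero_iff_norm_tendsto_zero]
  have h2 := (Real.continuous_sqrt.tendsto 0).comp h1
  simpa [Function.comp_def, Real.sqrt_sq (norm_nonneg _)] using h2

lemma tendsto_average_of_eventuallyEq {x y : ℕ → H} {v : H} {N : ℕ}
    (hxy : ∀ l, N ≤ l → x l = y l)
    (hy : Tendsto (fun n : ℕ => (n : ℂ)⁻¹ • ∑ l ∈ Finset.range n, y l) atTop (𝓝 v)) :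
    Tendsto (fun n : ℕ => (n : ℂ)⁻¹ • ∑ l ∈ Finset.range n, x l) atTop (𝓝 v) := by
  have h0 : Tendsto (fun n : ℕ => (n : ℂ)⁻¹ • ∑ l ∈ Finset.range N, (x l - y l)) atTop (𝓝 0) := by
    simpa using (tendsto_inv_atTop_nhds_zero_nat (𝕜 := ℂ)).smul_const
      (∑ l ∈ Finset.range N, (x l - y l))
  have h1 := h0.add hy
  rw [zero_add] at h1
  refine h1.congr' ?_
  filter_upwards [eventually_ge_atTop N] with n hn
  rw [← smul_add]
  congr 1
  have : ∑ l ∈ Finset.range N, (x l - y l) = ∑ l ∈ Finset.range n, (x l - y l) := by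
    refine Finset.sum_subset (Finset.range_subset_range.2 hn) fun l _ hl => ?_
    rw [hxy l (by simpa using hl), sub_self]
  rw [this, Finset.sum_sub_distrib, sub_add_cancel]

/-- Strong convergence of contractions may be checked on a set with dense span. -/
lemma tendsto_of_dense_span {U : ℕ → (H →L[ℂ] H)} {T : H →L[ℂ] H} (hU : ∀ n, ‖U n‖ ≤ 1)
    {S : Set H} (hS : Dense (Submodule.span ℂ S : Set H))
    (h : ∀ v ∈ S, Tendsto (fun n => U n v) atTop (𝓝 (T v))) (v : H) :
    Tendsto (fun n => U n v) atTop (𝓝 (T v)) := by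
  have hspan : ∀ v ∈ Submodule.span ℂ S, Tendsto (fun n => U n v) atTop (𝓝 (T v)) := by
    intro v hv
    induction hv using Submodule.span_induction with
    | mem v hv => exact h v hv
    | zero => simp
    | add u v _ _ hu hv => simpa using hu.add hv
    | smul c u _ hu => simpa using hu.const_smul c
  rw [Metric.tendsto_atTop]
  intro ε hε
  have hδ : 0 < ε / (2 * (2 + ‖T‖)) := by positivity
  obtain ⟨w, hw, hvw⟩ := Metric.dense_iff.1 hS v _ hδ
  obtain ⟨N, hN⟩ := Metric.tendsto_atTop.1 (hspan w hvw) (ε / 2) (half_pos hε)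
  refine ⟨N, fun n hn => ?_⟩
  have hw' : ‖v - w‖ < ε / (2 * (2 + ‖T‖)) := by
    rw [← dist_eq_norm, dist_comm]
    exact hw
  have h1 : ‖U n (v - w)‖ ≤ 1 * ‖v - w‖ :=
    (U n).le_of_opNorm_le (hU n) _
  have h2 : ‖T (v - w)‖ ≤ ‖T‖ * ‖v - w‖ := T.le_opNorm _
  have h3 := hN n hn
  rw [dist_eq_norm] at h3 ⊢
  have h4 : U n v - T v = U n (v - w) + (U n w - T w) - T (v - w) := by
    simp only [map_sub]
    abel
  have h5 : (1 + ‖T‖) * ‖v - w‖ ≤ ε / 2 := by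
    calc (1 + ‖T‖) * ‖v - w‖ ≤ (2 + ‖T‖) * (ε / (2 * (2 + ‖T‖))) := by
          gcongr
          norm_num
      _ = ε / 2 := by field_simp
  calc ‖U n v - T v‖ ≤ ‖U n (v - w)‖ + ‖U n w - T w‖ + ‖T (v - w)‖ := by
        rw [h4]
        exact (norm_sub_le _ _).trans (by gcongr; exact norm_add_le _ _)
    _ < ε := by nlinarith

end Averages

/-- The weak law of large numbers for the product vector state. -/
lemma tendsto_average_siteOp (t : Module.End ℂ M2) (a : ElemTensor p) :
    Tendsto (fun n : ℕ => (n : ℂ)⁻¹ • ∑ l ∈ Finset.range n, siteOp l t (tensor a)) atTop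
      (𝓝 (hs (refMatrix p) (t (refMatrix p)) • tensor a)) := by
  set c := hs (refMatrix p) (t (refMatrix p)) with hc
  set u : M2 := t (refMatrix p) - c • refMatrix p with hu
  have hu0 : hs (refMatrix p) u = 0 := by
    rw [hu, sub_eq_add_neg, ← neg_smul, hs_add_right, hs_smul_right, hs_refMatrix, ← hc]
    ring
  have hu0' : hs u (refMatrix p) = 0 := by rw [← hs_conj, hu0, map_zero]
  obtain ⟨N, hN⟩ := eventually_atTop.1 a.eventually_ref
  -- The fluctuation at the site $l$, meaningful only where $a_l=m$. Because $u\perp m$,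
  -- fluctuations at different sites are orthogonal, and beyond $N$ they all have the same norm.
  -- Finitely many terms do not affect the average.
  let y : ℕ → TensorH p := fun l => if N ≤ l then tensor (a.update l u) else 0
  have hy : ∀ l, N ≤ l → siteOp l t (tensor a) - c • tensor a = y l := fun l hl => by
    simp only [y, if_pos hl]
    rw [siteOp_tensor, ← slot_apply, ← slot_self a l, hN l hl, ← map_smul, ← map_sub, ← hu,
      slot_apply]
  have horth : ∀ k l, k ≠ l → inner ℂ (y k) (y l) = 0 := fun k l hkl => by
    by_cases hk : N ≤ k
    · by_cases hl : N ≤ l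
      · simp only [y, if_pos hk, if_pos hl]
        rw [inner_tensor, elemInner_factor _ _ k, ElemTensor.update_same,
          ElemTensor.update_of_ne _ hkl, hN k hk, hu0', zero_mul]
      · simp [y, hl]
    · simp [y, hk]
  have hnorm : ∀ l, ‖y l‖ ≤ Real.sqrt ‖hs u u * elemInner a a‖ := fun l => by
    by_cases hl : N ≤ l
    · have h : ‖y l‖ ^ 2 = ‖hs u u * elemInner a a‖ := by
        have h1 : (inner ℂ (y l) (y l) : ℂ) = hs u u * elemInner a a := by
          simp only [y, if_pos hl]
          rw [inner_tensor, elemInner_factor _ _ l, ElemTensor.update_same,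
            ElemTensor.update_update, ← hN l hl, ElemTensor.update_eq_self]
        rw [← h1, inner_self_eq_norm_sq_to_K]
        simp
      rw [← h, Real.sqrt_sq (norm_nonneg _)]
    · simp only [y, if_neg hl, norm_zero]
      positivity
  have h0 := tendsto_average_of_eventuallyEq hy
    (tendsto_average_of_orthogonal y _ horth hnorm)
  have h1 := h0.add_const (c • tensor a)
  rw [zero_add] at h1
  refine h1.congr' ?_
  filter_upwards [eventually_gt_atTop 0] with n hn
  have hn' : (n : ℂ) ≠ 0 := Nat.cast_ne_zero.2 hn.ne'
  rw [Finset.sum_sub_distrib, smul_sub, Finset.sum_const, Finset.card_range,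
    ← Nat.cast_smul_eq_nsmul ℂ, smul_smul, inv_mul_cancel₀ hn', one_smul, sub_add_cancel]

/-! ### The Okounkov operators -/

/-- The matrix of the Okounkov operators. -/
def okMatrix (p : PMF Site) (σ : Bool) : M2 :=
  Matrix.of fun i j => hs (refMatrix p) (side σ (Matrix.single j i 1) (refMatrix p))

lemma norm_coe_unitary_le {H : Type*} [NormedAddCommGroup H] [InnerProductSpace ℂ H]
    [CompleteSpace H] (u : unitary (H →L[ℂ] H)) : ‖(u : H →L[ℂ] H)‖ ≤ 1 := by
  refine ContinuousLinearMap.opNorm_le_bound _ zero_le_one fun x => ?_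
  rw [one_mul]
  exact ((ContinuousLinearMap.norm_map_iff_adjoint_comp_self (u : H →L[ℂ] H)).2
    (Unitary.mem_iff.1 u.2).1 x).le

lemma norm_average_le {H : Type*} [NormedAddCommGroup H] [InnerProductSpace ℂ H]
    (U : ℕ → (H →L[ℂ] H)) (hU : ∀ l, ‖U l‖ ≤ 1) (n : ℕ) :
    ‖(n : ℂ)⁻¹ • ∑ l ∈ Finset.range n, U l‖ ≤ 1 := by
  rw [norm_smul, norm_inv, Complex.norm_natCast]
  have h : ‖∑ l ∈ Finset.range n, U l‖ ≤ n :=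
    (norm_sum_le _ _).trans ((Finset.sum_le_sum fun l _ => hU l).trans_eq (by simp))
  rcases Nat.eq_zero_or_pos n with rfl | hn
  · simp
  · have hn' : (0 : ℝ) < n := Nat.cast_pos.2 hn
    rw [inv_mul_le_iff₀ hn', mul_one]
    exact h

lemma norm_conj_unitary_le (J : L2X p ≃ₗᵢ[ℂ] TensorH p) (u : unitary (L2X p →L[ℂ] L2X p)) :
    ‖J.conjStarAlgEquiv (u : L2X p →L[ℂ] L2X p)‖ ≤ 1 := by
  refine ContinuousLinearMap.opNorm_le_bound _ zero_le_one fun x => ?_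
  rw [LinearIsometryEquiv.conjStarAlgEquiv_apply_apply, J.norm_map, ← J.symm.norm_map x]
  exact (u : L2X p →L[ℂ] L2X p).le_of_opNorm_le (norm_coe_unitary_le u) _

/-- The averaged flip is $\sum_{i,j}E_{ij}$ at $k$ times the mean of $E_{ji}$ over the sites $l$,
and that mean tends to the scalar $\langle m,E_{ji}m\rangle$. Averages are contractions, so
elementary tensors suffice. -/
lemma tendsto_average_transp (hp : ∀ z, p z ≠ 0)
    {π : Wreath × Wreath →* unitary (L2X p →L[ℂ] L2X p)} (hπ : IsRepMu p π)
    {J : L2X p ≃ₗᵢ[ℂ] TensorH p} (hJ : IsTensorId p J) (σ : Bool) (k : ℕ) (v : TensorH p) :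
    Tendsto (fun n : ℕ => (n : ℂ)⁻¹ • ∑ l ∈ Finset.range n,
      J.conjStarAlgEquiv (π (sideEmb σ (permG (transp k l)))) v) atTop
      (𝓝 (siteOp k (side σ (okMatrix p σ)) v)) := by
  have h := tendsto_of_dense_span (H := TensorH p)
    (U := fun n : ℕ => (n : ℂ)⁻¹ • ∑ l ∈ Finset.range n,
      J.conjStarAlgEquiv (π (sideEmb σ (permG (transp k l))) : L2X p →L[ℂ] L2X p))
    (T := siteOp k (side σ (okMatrix p σ)))
    (norm_average_le _ fun l => norm_conj_unitary_le J _)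
    (dense_span_tensor (p := p)) ?_ v
  · simpa only [_root_.smul_apply, _root_.sum_apply] using h
  rintro _ ⟨a, rfl⟩
  simp only [_root_.smul_apply, _root_.sum_apply]
  -- Starting beyond $k$ discards the term $l=k$, to which the flip formula does not apply.
  refine tendsto_average_of_eventuallyEq (N := k + 1) (y := fun l =>
    ∑ i : Fin 2, ∑ j : Fin 2, siteOp k (side σ (Matrix.single i j 1))
          (siteOp l (side σ (Matrix.single j i 1)) (tensor a))) (fun l hl => ?_) ?_
  · rw [conj_transp hp hπ hJ σ (show k ≠ l by omega)]
    simp only [_root_.sum_apply, mul_apply_eq_comp]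
  have h1 : ∀ i j : Fin 2, Tendsto (fun n : ℕ => siteOp (p := p) k (side σ (Matrix.single i j 1))
      ((n : ℂ)⁻¹ • ∑ l ∈ Finset.range n, siteOp l (side σ (Matrix.single j i 1)) (tensor a))) atTop
      (𝓝 (siteOp k (side σ (Matrix.single i j 1)) (okMatrix p σ i j • tensor a))) := fun i j =>
    ((ContinuousLinearMap.continuous _).tendsto _).comp (tendsto_average_siteOp _ a)
  have h2 := tendsto_finsetSum Finset.univ fun i _ =>
    tendsto_finsetSum Finset.univ fun j _ => h1 i j
  have h3 : siteOp k (side σ (okMatrix p σ)) (tensor a) = ∑ i : Fin 2, ∑ j : Fin 2,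
      siteOp k (side σ (Matrix.single i j 1)) (okMatrix p σ i j • tensor a) := by
    conv_lhs => rw [Matrix.matrix_eq_sum_single (okMatrix p σ)]
    simp only [map_sum, _root_.sum_apply]
    refine Finset.sum_congr rfl fun i _ => Finset.sum_congr rfl fun j _ => ?_
    rw [map_smul, show Matrix.single i j (okMatrix p σ i j)
      = okMatrix p σ i j • Matrix.single i j (1 : ℂ) by simp, map_smul, map_smul]
    rfl
  rw [h3]
  refine h2.congr fun n => Eq.symm ?_
  rw [Finset.sum_comm, Finset.smul_sum]
  refine Finset.sum_congr rfl fun i _ => ?_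
  rw [Finset.sum_comm, Finset.smul_sum]
  refine Finset.sum_congr rfl fun j _ => ?_
  rw [map_smul, map_sum]

/-- Each of these entries is a sum of two products of positive square roots. -/
lemma okMatrix_offdiag (hp : ∀ z, p z ≠ 0) (σ : Bool) :
    okMatrix p σ 0 1 ≠ 0 ∧ okMatrix p σ 1 0 ≠ 0 := by
  have hpos : ∀ z, 0 < Real.sqrt (p z).toReal := fun z =>
    Real.sqrt_pos.2 (ENNReal.toReal_pos (hp z) (p.apply_ne_top z))
  have h1 : ∀ x y z w : Site, ((Real.sqrt (p x).toReal : ℂ) * (Real.sqrt (p y).toReal : ℂ)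
      + (Real.sqrt (p z).toReal : ℂ) * (Real.sqrt (p w).toReal : ℂ)) ≠ 0 := fun x y z w => by
    have := add_pos (mul_pos (hpos x) (hpos y)) (mul_pos (hpos z) (hpos w))
    exact_mod_cast this.ne'
  cases σ <;> constructor <;>
    simpa [okMatrix, hs_apply, Fintype.sum_prod_type, Matrix.mul_apply, Matrix.single_apply,
      refMatrix, siteMatrix] using h1 _ _ _ _

/-- The sign matrix yields the diagonal units $E_{ii}$, and $E_{ii}QE_{jj}=Q_{ij}E_{ij}$ then yields
the off-diagonal ones. -/
lemma subalgebra_eq_top {A : Subalgebra ℂ M2} {Q : M2} (hZ : signMatrix 1 ∈ A) (hQ : Q ∈ A)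
    (h01 : Q 0 1 ≠ 0) (h10 : Q 1 0 ≠ 0) : A = ⊤ := by
  have h1 : (1 : ZMod 2).val = 1 := rfl
  have hE : ∀ i : Fin 2, (Matrix.single i i 1 : M2) ∈ A := by
    intro i
    fin_cases i
    · have : (Matrix.single 0 0 1 : M2) = (2⁻¹ : ℂ) • (1 + signMatrix 1) := by
        ext i j
        fin_cases i <;> fin_cases j <;> (simp [signMatrix, h1]; try norm_num)
      exact this ▸ A.smul_mem (A.add_mem A.one_mem hZ) _
    · have : (Matrix.single 1 1 1 : M2) = (2⁻¹ : ℂ) • (1 - signMatrix 1) := by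
        ext i j
        fin_cases i <;> fin_cases j <;> (simp [signMatrix, h1]; try norm_num)
      exact this ▸ A.smul_mem (A.sub_mem A.one_mem hZ) _
  have hsingle : ∀ i j : Fin 2, (Matrix.single i j 1 : M2) ∈ A := by
    have hoff : ∀ i j : Fin 2, Q i j ≠ 0 → (Matrix.single i j 1 : M2) ∈ A := fun i j hij => by
      have : (Matrix.single i j 1 : M2)
          = (Q i j)⁻¹ • (Matrix.single i i 1 * Q * Matrix.single j j 1) := by
        rw [Matrix.single_mul_mul_single]
        simp [hij]
      exact this ▸ A.smul_mem (A.mul_mem (A.mul_mem (hE i) hQ) (hE j)) _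
    intro i j
    fin_cases i <;> fin_cases j
    exacts [hE 0, hoff 0 1 h01, hoff 1 0 h10, hE 1]
  refine eq_top_iff.2 fun x _ => ?_
  rw [Matrix.matrix_eq_sum_single x]
  refine A.sum_mem fun i _ => A.sum_mem fun j _ => ?_
  rw [show Matrix.single i j (x i j) = x i j • Matrix.single i j (1 : ℂ) by simp]
  exact A.smul_mem (hsingle i j) _

/-! ### The generated algebras -/

lemma image_centralizer {A B : Type*} [Mul A] [Mul B] (e : A ≃* B) (S : Set A) :
    e '' S.centralizer = (e '' S).centralizer := by
  ext b
  constructor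
  · rintro ⟨a, ha, rfl⟩ _ ⟨s, hs, rfl⟩
    rw [← map_mul, ← map_mul, ha s hs]
  · intro hb
    refine ⟨e.symm b, fun s hs => e.injective ?_, e.apply_symm_apply b⟩
    rw [map_mul, map_mul, e.apply_symm_apply]
    exact hb _ ⟨s, hs, rfl⟩

lemma sideMul_union_star (σ : Bool) :
    {T : TensorH p →L[ℂ] TensorH p | ∃ b : LocalElem, IsSideMul σ b T}
      ∪ star '' {T | ∃ b : LocalElem, IsSideMul σ b T}
      = {T | ∃ b : LocalElem, IsSideMul σ b T} := by
  refine Set.union_eq_left.2 ?_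
  rintro _ ⟨T, ⟨b, hb⟩, rfl⟩
  exact ⟨_, hb.star⟩

lemma sideAlg_eq (σ : Bool) :
    sideAlg p σ = doubleCommutant {T | ∃ b : LocalElem, IsSideMul σ b T} := by
  rw [sideAlg, wstarGenerated, sideMul_union_star]

lemma finPerm_eq_top {K : Subgroup FinPerm} (h : ∀ k l, transp k l ∈ K) : K = ⊤ := by
  refine eq_top_iff.2 fun s _ => ?_
  have hs : s.1 ∈ Subgroup.closure {τ : Equiv.Perm ℕ | τ.IsSwap} := by
    rw [_root_.mem_closure_isSwap']
    exact s.2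
  have hle : Subgroup.closure {τ : Equiv.Perm ℕ | τ.IsSwap} ≤ K.map FinPerm.subtype := by
    rw [Subgroup.closure_le]
    rintro _ ⟨k, l, -, rfl⟩
    exact ⟨transp k l, h k l, rfl⟩
  obtain ⟨t, ht, hts⟩ := hle hs
  rwa [← Subtype.ext (a1 := t) (a2 := s) hts]

/-- The set of group elements whose operators commute with `T`. -/
def commSubgroup {H : Type*} [Monoid H] {G : Type*} [Group G] (ρ : G →* H) (T : H) :
    Subgroup G where
  carrier := {g | Commute (ρ g) T}
  one_mem' := by simp
  mul_mem' {g h} hg hh := by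
    simpa using Commute.mul_left hg hh
  inv_mem' {g} hg := by
    have h1 : ρ g⁻¹ * ρ g = 1 := by rw [← map_mul, inv_mul_cancel, map_one]
    have h2 : ρ g * ρ g⁻¹ = 1 := by rw [← map_mul, mul_inv_cancel, map_one]
    calc ρ g⁻¹ * T = ρ g⁻¹ * (T * ρ g) * ρ g⁻¹ := by simp [mul_assoc, h2]
      _ = T * ρ g⁻¹ := by rw [← hg.eq, ← mul_assoc, h1, one_mul]

/-- The representation of `G` on the side `σ`, in the tensor picture. -/
def tensorRep (π : Wreath × Wreath →* unitary (L2X p →L[ℂ] L2X p))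
    (J : L2X p ≃ₗᵢ[ℂ] TensorH p) (σ : Bool) : Wreath →* (TensorH p →L[ℂ] TensorH p) :=
  (J.conjStarAlgEquiv : (L2X p →L[ℂ] L2X p) →* (TensorH p →L[ℂ] TensorH p)).comp
    ((unitary (L2X p →L[ℂ] L2X p)).subtype.comp (π.comp (sideEmb σ)))

lemma tensorRep_apply (π : Wreath × Wreath →* unitary (L2X p →L[ℂ] L2X p))
    (J : L2X p ≃ₗᵢ[ℂ] TensorH p) (σ : Bool) (g : Wreath) :
    tensorRep π J σ g = J.conjStarAlgEquiv (π (sideEmb σ g)) := rfl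

/-- Signs are multiplications, transpositions are sums of products of multiplications, and these
generate $G$. -/
lemma commute_tensorRep (hp : ∀ z, p z ≠ 0)
    {π : Wreath × Wreath →* unitary (L2X p →L[ℂ] L2X p)} (hπ : IsRepMu p π)
    {J : L2X p ≃ₗᵢ[ℂ] TensorH p} (hJ : IsTensorId p J) {σ : Bool}
    {T : TensorH p →L[ℂ] TensorH p}
    (hT : ∀ b S, IsSideMul σ b S → Commute S T) (g : Wreath) : Commute (tensorRep π J σ g) T := by
  have hgamma : ∀ γ, gammaG γ ∈ commSubgroup (tensorRep π J σ) T := fun γ =>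
    hT _ _ (conj_gamma hp hπ hJ σ γ)
  have hperm : ∀ s, permG s ∈ commSubgroup (tensorRep π J σ) T := by
    have h : (commSubgroup (tensorRep π J σ) T).comap (SemidirectProduct.inr : FinPerm →* Wreath)
        = ⊤ := by
      refine finPerm_eq_top fun k l => ?_
      change Commute (tensorRep π J σ (permG (transp k l))) T
      by_cases hkl : k = l
      · have : transp k l = 1 := Subtype.ext (by rw [hkl]; exact Equiv.swap_self l)
        rw [this, permG_one, map_one]
        exact Commute.one_left T
      · rw [tensorRep_apply, conj_transp hp hπ hJ σ hkl]
        exact Commute.sum_left _ _ _ fun i _ => Commute.sum_left _ _ _ fun j _ =>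
          Commute.mul_left (hT _ _ (isSideMul_siteOp σ k _)) (hT _ _ (isSideMul_siteOp σ l _))
    intro s
    exact (eq_top_iff.1 h) (Subgroup.mem_top s)
  have := (commSubgroup (tensorRep π J σ) T).mul_mem (hgamma g.left.toAdd) (hperm g.right)
  have hg : gammaG g.left.toAdd * permG g.right = g := SemidirectProduct.inl_left_mul_inr_right g
  rwa [hg] at this

/-- The matrices whose multiplication at $k$ commutes with $T$ form an algebra. It contains
$\mathrm{diag}(1,-1)$, coming from a sign character, and $Q$, since commuting with $T$ survives
strong limits; so it is all of $M_2(\mathbb C)$. -/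
lemma commute_siteOp (hp : ∀ z, p z ≠ 0)
    {π : Wreath × Wreath →* unitary (L2X p →L[ℂ] L2X p)} (hπ : IsRepMu p π)
    {J : L2X p ≃ₗᵢ[ℂ] TensorH p} (hJ : IsTensorId p J) {σ : Bool}
    {T : TensorH p →L[ℂ] TensorH p}
    (hT : ∀ g, Commute (tensorRep π J σ g) T) (k : ℕ) (e : M2) :
    Commute (siteOp k (side σ e)) T := by
  let A : Subalgebra ℂ M2 :=
    (Subalgebra.centralizer ℂ {T}).comap ((siteOp k).comp (side σ))
  have hA : ∀ e, e ∈ A ↔ Commute (siteOp k (side σ e)) T := fun e => by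
    simp only [A, Subalgebra.mem_comap, Subalgebra.mem_centralizer_iff, Set.mem_singleton_iff,
      forall_eq]
    exact ⟨fun h => h.symm, fun h => h.symm⟩
  have hZ : signMatrix 1 ∈ A := by
    rw [hA]
    have h1 := conj_gamma hp hπ hJ σ (Finsupp.single k 1)
    have h2 := isSideMul_siteOp (p := p) σ k (signMatrix 1)
    have h3 : signElem (Finsupp.single k 1) = LocalElem.single k (signMatrix 1) := by
      refine LocalElem.ext fun i => ?_
      by_cases h : i = k
      · subst h
        simp [signElem, LocalElem.single]
      · simp [signElem, LocalElem.single, Finsupp.single_eq_of_ne h, signMatrix_zero, h]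
    rw [h3] at h1
    rw [h2.unique h1]
    exact hT _
  have hQ : okMatrix p σ ∈ A := by
    rw [hA]
    refine ContinuousLinearMap.ext fun v => ?_
    have h1 := tendsto_average_transp hp hπ hJ σ k (T v)
    have h2 := (T.continuous.tendsto _).comp (tendsto_average_transp hp hπ hJ σ k v)
    refine tendsto_nhds_unique h1 (h2.congr fun n => ?_)
    simp only [Function.comp_apply, map_smul, map_sum]
    congr 1
    refine Finset.sum_congr rfl fun l _ => ?_
    exact (DFunLike.congr_fun (hT (permG (transp k l))).eq v).symm
  have htop := subalgebra_eq_top hZ hQ (okMatrix_offdiag hp σ).1 (okMatrix_offdiag hp σ).2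
  exact (hA e).1 (htop ▸ Algebra.mem_top)

lemma commute_sideMul (hp : ∀ z, p z ≠ 0)
    {π : Wreath × Wreath →* unitary (L2X p →L[ℂ] L2X p)} (hπ : IsRepMu p π)
    {J : L2X p ≃ₗᵢ[ℂ] TensorH p} (hJ : IsTensorId p J) {σ : Bool}
    {T : TensorH p →L[ℂ] TensorH p}
    (hT : ∀ g, Commute (tensorRep π J σ g) T) {b : LocalElem} {S : TensorH p →L[ℂ] TensorH p}
    (hS : IsSideMul σ b S) : Commute S T := by
  have hprod : ∀ n, Commute (prodOp σ b.toFun n) T := fun n => by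
    induction n with
    | zero => exact Commute.one_left T
    | succ n ih => exact Commute.mul_left ih (commute_siteOp hp hπ hJ hT n _)
  obtain ⟨N, hN⟩ := eventually_atTop.1 b.eventually_one
  rw [hS.unique (isSideMul_prodOp σ b.toFun N b (fun _ _ => rfl) hN)]
  exact hprod N

lemma doubleCommutant_rep (hp : ∀ z, p z ≠ 0)
    {π : Wreath × Wreath →* unitary (L2X p →L[ℂ] L2X p)} (hπ : IsRepMu p π)
    {J : L2X p ≃ₗᵢ[ℂ] TensorH p} (hJ : IsTensorId p J) (σ : Bool) :
    doubleCommutant (Set.range fun g => (π (sideEmb σ g) : L2X p →L[ℂ] L2X p))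
      = pullOp J '' sideAlg p σ := by
  let e : (TensorH p →L[ℂ] TensorH p) ≃* (L2X p →L[ℂ] L2X p) :=
    (J.conjStarAlgEquiv.symm : (TensorH p →L[ℂ] TensorH p) ≃* (L2X p →L[ℂ] L2X p))
  -- It suffices to compare first commutants; the unitary conjugation then carries commutants to
  -- commutants.
  have hcent : Set.centralizer {T : TensorH p →L[ℂ] TensorH p | ∃ b, IsSideMul σ b T}
      = Set.centralizer (Set.range (tensorRep π J σ)) := by
    ext T
    constructor
    · rintro hT _ ⟨g, rfl⟩
      exact commute_tensorRep hp hπ hJ (fun b S hS => hT S ⟨b, hS⟩) g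
    · rintro hT S ⟨b, hS⟩
      exact commute_sideMul hp hπ hJ (fun g => hT _ ⟨g, rfl⟩) hS
  change _ = e '' sideAlg p σ
  rw [sideAlg_eq, doubleCommutant, doubleCommutant, hcent, image_centralizer, image_centralizer,
    ← Set.range_comp]
  congr 3
  funext g
  exact (J.conjStarAlgEquiv.symm_apply_apply _).symm

/-! ### Modular operators of approximately finite-dimensional pairs -/

section Modular

variable {H : Type*} [NormedAddCommGroup H] [InnerProductSpace ℂ H] [CompleteSpace H]

/-- A commuting pair of `*`-closed sets of operators and an increasing sequence of
finite-dimensional subspaces with dense union, each of which both sets reach from `ξ` by operators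
whose adjoints also map `ξ` into the subspace. -/
structure TomitaPair (M N : Set (H →L[ℂ] H)) (ξ : H) (K : ℕ → Submodule ℂ H) : Prop where
  star_left : ∀ a ∈ M, star a ∈ M
  star_right : ∀ b ∈ N, star b ∈ N
  comm : ∀ a ∈ M, ∀ b ∈ N, a * b = b * a
  mono : Monotone K
  finite : ∀ n, FiniteDimensional ℂ (K n)
  dense : Dense ((⨆ n, K n : Submodule ℂ H) : Set H)
  lift_left : ∀ n, ∀ x ∈ K n, ∃ a ∈ M, a ξ = x ∧ (star a) ξ ∈ K n
  lift_right : ∀ n, ∀ x ∈ K n, ∃ b ∈ N, b ξ = x ∧ (star b) ξ ∈ K n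

namespace TomitaPair

variable {M N : Set (H →L[ℂ] H)} {ξ : H} {K : ℕ → Submodule ℂ H}

lemma symm (h : TomitaPair M N ξ K) : TomitaPair N M ξ K where
  star_left := h.star_right
  star_right := h.star_left
  comm b hb a ha := (h.comm a ha b hb).symm
  mono := h.mono
  finite := h.finite
  dense := h.dense
  lift_left := h.lift_right
  lift_right := h.lift_left

lemma cyclic (h : TomitaPair M N ξ K) : Dense {v : H | ∃ a ∈ M, v = a ξ} := by
  refine h.dense.mono fun x hx => ?_
  obtain ⟨n, hn⟩ := (Submodule.mem_iSup_of_directed _ h.mono.directed_le).1 hx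
  obtain ⟨a, ha, hax, -⟩ := h.lift_left n x hn
  exact ⟨a, ha, hax.symm⟩

/-- Both sides are $\langle\xi,ab\,\xi\rangle=\langle\xi,ba\,\xi\rangle$. -/
lemma inner_star (h : TomitaPair M N ξ K) {a b : H →L[ℂ] H} (ha : a ∈ M) (hb : b ∈ N) :
    inner ℂ ((star b) ξ) (a ξ) = inner ℂ ((star a) ξ) (b ξ) := by
  rw [ContinuousLinearMap.star_eq_adjoint, ContinuousLinearMap.star_eq_adjoint,
    ContinuousLinearMap.adjoint_inner_left, ContinuousLinearMap.adjoint_inner_left,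
    ← mul_apply_eq_comp, ← mul_apply_eq_comp, h.comm a ha b hb]

/-- Compression of the adjoint relation to one of the subspaces. -/
lemma exists_compression (h : TomitaPair M N ξ K) {u v : H}
    (huv : ∀ b ∈ N, inner ℂ ((star b) ξ) u = inner ℂ v (b ξ)) (n : ℕ) :
    haveI := h.finite n
    ∃ a ∈ M, a ξ = (K n).starProjection u ∧ (star a) ξ = (K n).starProjection v := by
  have := h.finite n
  obtain ⟨a, ha, hau, hK⟩ := h.lift_left n _ ((K n).starProjection_apply_mem u)
  refine ⟨a, ha, hau, ?_⟩
  have hproj : ∀ x ∈ K n, ∀ w, inner ℂ x ((K n).starProjection w) = inner ℂ x w :=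
    fun x hx w => by
      rw [← Submodule.inner_starProjection_left_eq_right,
        Submodule.starProjection_eq_self_iff.2 hx]
  rw [← sub_eq_zero, ← inner_self_eq_zero (𝕜 := ℂ)]
  -- The difference $a^*\xi-P_nv$ lies in $K_n$, so it is some $b\xi$ with $b^*\xi\in K_n$. Testing
  -- against $b$, the projections can be dropped on both sides and the difference is orthogonal to
  -- itself.
  have hd := (K n).sub_mem hK ((K n).starProjection_apply_mem v)
  obtain ⟨b, hb, hbx, hbK⟩ := h.lift_right n _ hd
  have h1 : inner ℂ ((star a) ξ) (b ξ) = inner ℂ v (b ξ) := by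
    rw [← h.inner_star ha hb, hau, hproj _ hbK, huv b hb]
  have h2 : inner ℂ ((K n).starProjection v) (b ξ) = inner ℂ v (b ξ) := by
    rw [← inner_conj_symm, hproj _ (hbx ▸ hd), inner_conj_symm]
  conv_lhs => rw [inner_sub_left, ← hbx]
  rw [h1, h2, sub_self]

lemma mem_graph_of_compression (h : TomitaPair M N ξ K) {R : Set (H × H)} {u w : H}
    (hR : ∀ n, haveI := h.finite n
      ((K n).starProjection u, (K n).starProjection w) ∈ R) : (u, w) ∈ closure R := by
  have := h.finite
  have hd : ⊤ ≤ (⨆ n, K n).topologicalClosure := by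
    rw [top_le_iff, Submodule.dense_iff_topologicalClosure_eq_top.1 h.dense]
  have hu := Submodule.starProjection_tendsto_self K h.mono u hd
  have hw := Submodule.starProjection_tendsto_self K h.mono w hd
  exact mem_closure_of_tendsto (hu.prodMk_nhds hw) (Eventually.of_forall hR)

/-- The closed graph of $S$ is the full graph of the adjoint of $b\xi\mapsto b^*\xi$. One inclusion
is closedness of the relation; the other approximates $(u,v)$ by its compressions, which are of the
form $(a\xi,a^*\xi)$. -/
lemma mem_tomitaGraph_iff (h : TomitaPair M N ξ K) (u v : H) :
    (u, v) ∈ tomitaGraph M ξ ↔ ∀ b ∈ N, inner ℂ ((star b) ξ) u = inner ℂ v (b ξ) := by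
  constructor
  · intro huv b hb
    have hc : IsClosed {z : H × H | inner ℂ ((star b) ξ) z.1 = inner ℂ z.2 (b ξ)} :=
      isClosed_eq (by fun_prop) (by fun_prop)
    refine closure_minimal ?_ hc huv
    rintro _ ⟨a, ha, rfl⟩
    exact h.inner_star ha hb
  · intro huv
    refine h.mem_graph_of_compression fun n => ?_
    obtain ⟨a, ha, h1, h2⟩ := h.exists_compression huv n
    exact ⟨a, ha, by rw [h1, h2]⟩

lemma compression_mem (h : TomitaPair M N ξ K) {u v : H} (huv : (u, v) ∈ tomitaGraph M ξ) (n : ℕ) :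
    haveI := h.finite n
    ((K n).starProjection u, (K n).starProjection v) ∈ tomitaGraph M ξ := by
  obtain ⟨a, ha, h1, h2⟩ := h.exists_compression ((h.mem_tomitaGraph_iff u v).1 huv) n
  exact subset_closure ⟨a, ha, by rw [h1, h2]⟩

lemma closable (h : TomitaPair M N ξ K) (u v w : H) (hv : (u, v) ∈ tomitaGraph M ξ)
    (hw : (u, w) ∈ tomitaGraph M ξ) : v = w := by
  refine h.symm.cyclic.eq_of_inner_left (𝕜 := ℂ) ?_
  rintro _ ⟨b, hb, rfl⟩
  rw [← (h.mem_tomitaGraph_iff u v).1 hv b hb, ← (h.mem_tomitaGraph_iff u w).1 hw b hb]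

lemma separating (h : TomitaPair M N ξ K) (a : H →L[ℂ] H) (ha : a ∈ M) (h0 : a ξ = 0) : a = 0 := by
  refine DFunLike.coe_injective
    (Continuous.ext_on h.symm.cyclic a.continuous (0 : H →L[ℂ] H).continuous ?_)
  rintro _ ⟨b, hb, rfl⟩
  rw [← mul_apply_eq_comp, h.comm a ha b hb, mul_apply_eq_comp, h0, map_zero]
  rfl

lemma adjoint (h : TomitaPair M N ξ K) (u v : H) : (u, v) ∈ tomitaGraph N ξ ↔
    ∀ x y, (x, y) ∈ tomitaGraph M ξ → inner ℂ y u = inner ℂ v x := by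
  rw [h.symm.mem_tomitaGraph_iff]
  constructor
  · intro huv x y hxy
    have hc : IsClosed {z : H × H | inner ℂ z.2 u = inner ℂ v z.1} :=
      isClosed_eq (by fun_prop) (by fun_prop)
    refine closure_minimal ?_ hc hxy
    rintro _ ⟨a, ha, rfl⟩
    exact huv a ha
  · intro huv a ha
    exact huv _ _ (subset_closure ⟨a, ha, rfl⟩)

/-- The graph of `F S`. -/
def modularGraph (h : TomitaPair M N ξ K) : Submodule ℂ (H × H) where
  carrier := {z | ∃ v, (z.1, v) ∈ tomitaGraph M ξ ∧ (v, z.2) ∈ tomitaGraph N ξ}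
  zero_mem' := ⟨0, by simp [h.mem_tomitaGraph_iff], by simp [h.symm.mem_tomitaGraph_iff]⟩
  add_mem' := by
    rintro ⟨u, w⟩ ⟨u', w'⟩ ⟨v, h1, h2⟩ ⟨v', h1', h2'⟩
    rw [h.mem_tomitaGraph_iff] at h1 h1'
    rw [h.symm.mem_tomitaGraph_iff] at h2 h2'
    refine ⟨v + v', (h.mem_tomitaGraph_iff _ _).2 fun b hb => ?_,
      (h.symm.mem_tomitaGraph_iff _ _).2 fun b hb => ?_⟩
    · change inner ℂ _ (u + u') = inner ℂ (v + v') (b ξ)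
      rw [inner_add_right, h1 b hb, h1' b hb, inner_add_left]
    · change inner ℂ _ (v + v') = inner ℂ (w + w') (b ξ)
      rw [inner_add_right, h2 b hb, h2' b hb, inner_add_left]
  smul_mem' := by
    rintro c ⟨u, w⟩ ⟨v, h1, h2⟩
    rw [h.mem_tomitaGraph_iff] at h1
    rw [h.symm.mem_tomitaGraph_iff] at h2
    -- The intermediate vector takes the conjugate scalar, as $S$ and $F$ are antilinear and only
    -- their product is linear.
    refine ⟨(starRingEnd ℂ c) • v, (h.mem_tomitaGraph_iff _ _).2 fun b hb => ?_,
      (h.symm.mem_tomitaGraph_iff _ _).2 fun b hb => ?_⟩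
    · change inner ℂ _ (c • u) = inner ℂ (starRingEnd ℂ c • v) (b ξ)
      rw [inner_smul_right, h1 b hb, inner_smul_left, Complex.conj_conj]
    · change inner ℂ _ (starRingEnd ℂ c • v) = inner ℂ (c • w) (b ξ)
      rw [inner_smul_right, h2 b hb, inner_smul_left]

lemma mem_modularGraph (h : TomitaPair M N ξ K) {u w : H} : (u, w) ∈ h.modularGraph ↔
    ∃ v, (u, v) ∈ tomitaGraph M ξ ∧ (v, w) ∈ tomitaGraph N ξ := Iff.rfl

lemma zero_mem_graph (h : TomitaPair M N ξ K) : ((0 : H), (0 : H)) ∈ tomitaGraph M ξ := by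
  simp [h.mem_tomitaGraph_iff]

lemma sub_mem_graph (h : TomitaPair M N ξ K) {u v u' v' : H} (h1 : (u, v) ∈ tomitaGraph M ξ)
    (h2 : (u', v') ∈ tomitaGraph M ξ) : (u - u', v - v') ∈ tomitaGraph M ξ := by
  rw [h.mem_tomitaGraph_iff] at h1 h2 ⊢
  intro b hb
  rw [inner_sub_right, inner_sub_left, h1 b hb, h2 b hb]

/-- From $\|Su\|^2=\langle FSu,u\rangle\le\|FSu\|\,\|u\|$, convergence of $u$ and $FSu$ forces the
intermediate vectors $Su$ to be Cauchy, and then the closed graphs of $S$ and $F$ pass to the limit.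
-/
lemma isClosed_modularGraph (h : TomitaPair M N ξ K) :
    IsClosed (h.modularGraph : Set (H × H)) := by
  refine IsSeqClosed.isClosed fun z z₀ hz hlim => ?_
  choose v hS hF using hz
  have hsq : ∀ m n, dist (v m) (v n) ^ 2 ≤ dist (z m) (z n) ^ 2 := fun m n => by
    have h1 := (h.adjoint _ _).1 (h.symm.sub_mem_graph (hF m) (hF n)) _ _
      (h.sub_mem_graph (hS m) (hS n))
    have h2 : ‖v m - v n‖ ^ 2 ≤ ‖(z m).2 - (z n).2‖ * ‖(z m).1 - (z n).1‖ := by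
      have h3 : ‖(inner ℂ (v m - v n) (v m - v n) : ℂ)‖ = ‖v m - v n‖ ^ 2 := by
        rw [inner_self_eq_norm_sq_to_K]
        simp
      rw [← h3, h1]
      exact norm_inner_le_norm _ _
    rw [← dist_eq_norm, ← dist_eq_norm, ← dist_eq_norm] at h2
    rw [Prod.dist_eq]
    refine h2.trans ?_
    rw [sq]
    exact mul_le_mul (le_max_right _ _) (le_max_left _ _) dist_nonneg (le_max_of_le_left dist_nonneg)
  have hle : ∀ m n, dist (v m) (v n) ≤ dist (z m) (z n) := fun m n =>
    le_of_sq_le_sq (hsq m n) dist_nonneg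
  have hcau : CauchySeq v := by
    rw [Metric.cauchySeq_iff]
    intro ε hε
    obtain ⟨N, hN⟩ := Metric.cauchySeq_iff.1 hlim.cauchySeq ε hε
    exact ⟨N, fun m hm n hn => (hle m n).trans_lt (hN m hm n hn)⟩
  obtain ⟨v₀, hv₀⟩ := cauchySeq_tendsto_of_complete hcau
  refine ⟨v₀, ?_, ?_⟩
  · exact isClosed_closure.mem_of_tendsto
      (((continuous_fst.tendsto z₀).comp hlim).prodMk_nhds hv₀) (Eventually.of_forall hS)
  · exact isClosed_closure.mem_of_tendsto
      (hv₀.prodMk_nhds ((continuous_snd.tendsto z₀).comp hlim)) (Eventually.of_forall hF)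

lemma modularGraph_fst_zero (h : TomitaPair M N ξ K) (z : H × H) (hz : z ∈ h.modularGraph)
    (h0 : z.1 = 0) : z.2 = 0 := by
  obtain ⟨u, w⟩ := z
  obtain ⟨v, hS, hF⟩ := hz
  dsimp only at h0 hS hF
  subst h0
  have hv := h.closable _ _ _ hS h.zero_mem_graph
  subst hv
  exact h.symm.closable _ _ _ hF h.symm.zero_mem_graph

/-- The modular operator of the pair. -/
def modularOp (h : TomitaPair M N ξ K) : H →ₗ.[ℂ] H := h.modularGraph.toLinearPMap

lemma graph_modularOp (h : TomitaPair M N ξ K) : h.modularOp.graph = h.modularGraph :=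
  Submodule.toLinearPMap_graph_eq _ h.modularGraph_fst_zero

lemma isModularOperator (h : TomitaPair M N ξ K) : IsModularOperator M N ξ h.modularOp where
  cyclic := h.cyclic
  separating := h.separating
  closable_S := h.closable
  closable_F := h.symm.closable
  adjoint := h.adjoint
  graph u w := by rw [graph_modularOp, h.mem_modularGraph]

/-- Compression to $K_n$ respects both $S$ and $F$, with the same compressed intermediate vector, so
it sends a point of the graph of $FS$ to another one over $K_n$; these converge to the given point.
-/
lemma hasCore (h : TomitaPair M N ξ K) : h.modularOp.HasCore (⨆ n, K n) := by
  have hdom : (⨆ n, K n) ≤ h.modularOp.domain := fun x hx => by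
    obtain ⟨n, hn⟩ := (Submodule.mem_iSup_of_directed _ h.mono.directed_le).1 hx
    obtain ⟨a, ha, rfl, haK⟩ := h.lift_left n x hn
    obtain ⟨b, hb, hbx, -⟩ := h.lift_right n _ haK
    refine LinearPMap.mem_domain_of_mem_graph (y := (star b) ξ) ?_
    rw [graph_modularOp]
    exact ⟨(star a) ξ, subset_closure ⟨a, ha, rfl⟩, subset_closure ⟨b, hb, by rw [hbx]⟩⟩
  refine ⟨hdom, LinearPMap.eq_of_eq_graph ?_⟩
  have hclosed : h.modularOp.IsClosed := by
    rw [LinearPMap.IsClosed, graph_modularOp]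
    exact h.isClosed_modularGraph
  have hle : h.modularOp.domRestrict (⨆ n, K n) ≤ h.modularOp := LinearPMap.domRestrict_le
  rw [← (hclosed.isClosable.leIsClosable hle).graph_closure_eq_closure_graph]
  refine le_antisymm (Submodule.topologicalClosure_minimal _ (LinearPMap.le_graph_of_le hle) hclosed)
    fun z hz => ?_
  obtain ⟨u, w⟩ := z
  rw [graph_modularOp] at hz
  obtain ⟨v, hS, hF⟩ := hz
  refine h.mem_graph_of_compression fun n => ?_
  have := h.finite n
  have hmem : ((K n).starProjection u, (K n).starProjection w) ∈ h.modularOp.graph := by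
    rw [graph_modularOp]
    exact ⟨_, h.compression_mem hS n, h.symm.compression_mem hF n⟩
  have hin : (K n).starProjection u ∈ ⨆ n, K n :=
    Submodule.mem_iSup_of_mem n ((K n).starProjection_apply_mem u)
  obtain ⟨y, hy1, hy2⟩ := (LinearPMap.mem_graph_iff _).1 hmem
  refine (LinearPMap.mem_graph_iff _).2 ⟨⟨(K n).starProjection u, hin, hdom hin⟩, rfl, ?_⟩
  rw [← hy2]
  exact LinearPMap.domRestrict_apply hy1.symm

end TomitaPair

end Modular

/-! ### The modular operator of the pair of multiplication algebras -/

lemma star_mem_centralizer_of_star_closed {A : Type*} [Semigroup A] [StarMul A] {S : Set A}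
    (hS : ∀ s ∈ S, star s ∈ S) : ∀ a ∈ S.centralizer, star a ∈ S.centralizer := fun a ha s hs => by
  rw [← star_star s, ← star_mul, ← star_mul, ha _ (hS s hs)]

lemma star_mem_sideAlg {σ : Bool} {T : TensorH p →L[ℂ] TensorH p} (hT : T ∈ sideAlg p σ) :
    star T ∈ sideAlg p σ := by
  rw [sideAlg_eq] at hT ⊢
  refine star_mem_centralizer_of_star_closed (star_mem_centralizer_of_star_closed ?_) T hT
  rintro S ⟨b, hb⟩
  exact ⟨_, hb.star⟩

lemma IsSideMul.mem_sideAlg {σ : Bool} {b : LocalElem} {T : TensorH p →L[ℂ] TensorH p}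
    (hT : IsSideMul σ b T) : T ∈ sideAlg p σ := by
  rw [sideAlg_eq]
  exact Set.subset_centralizer_centralizer ⟨b, hT⟩

lemma add_mem_sideAlg {σ : Bool} {S T : TensorH p →L[ℂ] TensorH p} (hS : S ∈ sideAlg p σ)
    (hT : T ∈ sideAlg p σ) : S + T ∈ sideAlg p σ :=
  Set.add_mem_centralizer hS hT

lemma smul_mem_sideAlg {σ : Bool} (c : ℂ) {T : TensorH p →L[ℂ] TensorH p}
    (hT : T ∈ sideAlg p σ) : c • T ∈ sideAlg p σ := fun S hS => by
  rw [mul_smul_comm, smul_mul_assoc, hT S hS]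

/-- Commutation of the generators is lifted one algebra at a time: first $S$ commutes with the right
multiplications, then $T$ with everything that does. -/
lemma sideAlg_comm {S T : TensorH p →L[ℂ] TensorH p} (hS : S ∈ sideAlg p false)
    (hT : T ∈ sideAlg p true) : S * T = T * S := by
  rw [sideAlg_eq] at hS hT
  have h : S ∈ Set.centralizer {T : TensorH p →L[ℂ] TensorH p | ∃ b, IsSideMul true b T} := by
    rintro R ⟨c, hc⟩
    refine hS R ?_
    rintro L ⟨b, hb⟩
    exact isSideMul_commute hb hc
  exact hT S h

/-- The span of the elementary tensors `a₀ ⊗ ⋯ ⊗ a_{n-1} ⊗ 𝔍_n(𝕀) ⊗ 𝔍_{n+1}(𝕀) ⊗ ⋯`. -/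
def truncated (p : PMF Site) (n : ℕ) : Submodule ℂ (TensorH p) :=
  Submodule.span ℂ {v | ∃ a : ElemTensor p, (∀ i, n ≤ i → a.toFun i = refMatrix p) ∧ v = tensor a}

lemma truncated_mono : Monotone (truncated p) := fun m n hmn => by
  refine Submodule.span_mono ?_
  rintro _ ⟨a, ha, rfl⟩
  exact ⟨a, fun i hi => ha i (hmn.trans hi), rfl⟩

lemma tensor_mem_truncated {n : ℕ} {a : ElemTensor p} (ha : ∀ i, n ≤ i → a.toFun i = refMatrix p) :
    tensor a ∈ truncated p n :=
  Submodule.subset_span ⟨a, ha, rfl⟩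

lemma span_tensor_le_iSup_truncated :
    Submodule.span ℂ (Set.range (tensor (p := p))) ≤ ⨆ n, truncated p n := by
  rw [Submodule.span_le]
  rintro _ ⟨a, rfl⟩
  obtain ⟨N, hN⟩ := eventually_atTop.1 a.eventually_ref
  exact Submodule.mem_iSup_of_mem N (tensor_mem_truncated hN)

lemma finiteDimensional_truncated (n : ℕ) : FiniteDimensional ℂ (truncated p n) := by
  induction n with
  | zero =>
    have h : truncated p 0 ≤ Submodule.span ℂ {refVector p} := by
      refine Submodule.span_mono ?_
      rintro _ ⟨a, ha, rfl⟩
      exact congrArg tensor (ElemTensor.ext fun i => ha i (Nat.zero_le i))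
    exact Submodule.finiteDimensional_of_le h
  | succ n ih =>
    -- The map $x\mapsto\langle m,x\rangle E_z$ sends $m$ to $E_z$, so the four operators at the
    -- site $n$ generate the next space from the previous one.
    let t : Site → Module.End ℂ M2 := fun z =>
      { toFun := fun x => hs (refMatrix p) x • Matrix.single z.1 z.2 1
        map_add' := fun x y => by rw [hs_add_right, add_smul]
        map_smul' := fun c x => by rw [hs_smul_right, mul_smul, RingHom.id_apply] }
    have h : truncated p (n + 1)
        ≤ ⨆ z : Site, (truncated p n).map (siteOp n (t z)).toLinearMap := by
      refine Submodule.span_le.2 ?_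
      rintro _ ⟨a, ha, rfl⟩
      have hb : tensor (a.update n (refMatrix p)) ∈ truncated p n :=
        tensor_mem_truncated fun i hi => by
          rcases hi.eq_or_lt with rfl | hi
          · exact ElemTensor.update_same _ _ _
          · rw [ElemTensor.update_of_ne _ hi.ne', ha i hi]
      have hsum : tensor a = ∑ z : Site, a.toFun n z.1 z.2 •
          siteOp n (t z) (tensor (a.update n (refMatrix p))) := by
        conv_lhs => rw [← slot_self a n, Matrix.matrix_eq_sum_single (a.toFun n)]
        rw [Fintype.sum_prod_type]
        simp only [map_sum]
        refine Finset.sum_congr rfl fun i _ => Finset.sum_congr rfl fun j _ => ?_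
        have h1 : t (i, j) (refMatrix p) = Matrix.single i j 1 := by
          change hs (refMatrix p) (refMatrix p) • Matrix.single i j 1 = _
          rw [hs_refMatrix, one_smul]
        rw [siteOp_tensor, ElemTensor.update_same, ElemTensor.update_update, h1, ← slot_apply,
          ← map_smul, Matrix.smul_single, smul_eq_mul, mul_one]
      rw [hsum]
      exact Submodule.sum_mem _ fun z _ => Submodule.smul_mem _ _
        (Submodule.mem_iSup_of_mem z ⟨_, hb, rfl⟩)
    exact Submodule.finiteDimensional_of_le h

/-! ### Reaching tensors from the reference vector by means of the inverse of $m$. -/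

lemma isUnit_refMatrix (h : (Matrix.of fun k l : Fin 2 => (p (k, l)).toReal).det ≠ 0) :
    IsUnit (refMatrix p) := by
  rw [Matrix.isUnit_iff_isUnit_det, isUnit_iff_ne_zero]
  intro h0
  refine h ?_
  rw [Matrix.det_fin_two] at h0 ⊢
  simp only [refMatrix, siteMatrix, Matrix.of_apply, Pi.one_apply, one_mul] at h0 ⊢
  -- Squaring $\sqrt{p_{00}p_{11}}=\sqrt{p_{01}p_{10}}$ would give $\det[p_{kl}]=0$.
  have h1 : Real.sqrt (p (0, 0)).toReal * Real.sqrt (p (1, 1)).toReal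
      = Real.sqrt (p (0, 1)).toReal * Real.sqrt (p (1, 0)).toReal := by
    exact_mod_cast sub_eq_zero.1 h0
  have h2 := congrArg (· ^ 2) h1
  simp only [mul_pow, Real.sq_sqrt ENNReal.toReal_nonneg] at h2
  rw [h2, sub_self]

/-- The matrix is $xm^{-1}$, or the transpose of $m^{-1}x$. The second clause keeps the resulting
element, and hence its adjoint, equal to $1$ at the sites where the tensor is already $m$. -/
lemma exists_side_refMatrix (hm : IsUnit (refMatrix p)) (σ : Bool) (x : M2) :
    ∃ e : M2, side σ e (refMatrix p) = x ∧ (x = refMatrix p → e = 1) := by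
  have hd := (Matrix.isUnit_iff_isUnit_det _).1 hm
  cases σ
  · refine ⟨x * (refMatrix p)⁻¹, ?_, fun h => ?_⟩
    · rw [side_false, Matrix.mul_assoc, Matrix.nonsing_inv_mul _ hd, Matrix.mul_one]
    · rw [h, Matrix.mul_nonsing_inv _ hd]
  · refine ⟨((refMatrix p)⁻¹ * x).transpose, ?_, fun h => ?_⟩
    · rw [side_true, Matrix.transpose_transpose, ← Matrix.mul_assoc, Matrix.mul_nonsing_inv _ hd,
        Matrix.one_mul]
    · rw [h, Matrix.nonsing_inv_mul _ hd, Matrix.transpose_one]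

lemma IsSideMul.apply_refVector {σ : Bool} {b : LocalElem} {T : TensorH p →L[ℂ] TensorH p}
    (hT : IsSideMul σ b T) {a : ElemTensor p}
    (h : ∀ i, side σ (b.toFun i) (refMatrix p) = a.toFun i) : T (refVector p) = tensor a :=
  (hT _).trans (congrArg tensor (ElemTensor.ext h))

lemma exists_isSideMul_refVector (hm : IsUnit (refMatrix p)) (σ : Bool) {n : ℕ} {a : ElemTensor p}
    (ha : ∀ i, n ≤ i → a.toFun i = refMatrix p) : ∃ b T, IsSideMul σ b T ∧
      T (refVector p) = tensor a ∧ (star T) (refVector p) ∈ truncated p n := by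
  choose e he he' using fun i => exists_side_refMatrix hm σ (a.toFun i)
  let b : LocalElem := ⟨e, eventually_atTop.2 ⟨n, fun i hi => he' i (ha i hi)⟩⟩
  obtain ⟨T, hT⟩ := exists_isSideMul (p := p) σ b
  refine ⟨b, T, hT, hT.apply_refVector he, ?_⟩
  rw [refVector, hT.star]
  refine tensor_mem_truncated fun i hi => ?_
  change side σ (e i).conjTranspose (refMatrix p) = refMatrix p
  rw [he' i (ha i hi), Matrix.conjTranspose_one, map_one, Module.End.one_apply]

lemma lift_truncated (hm : IsUnit (refMatrix p)) (σ : Bool) (n : ℕ) (x : TensorH p)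
    (hx : x ∈ truncated p n) :
    ∃ T ∈ sideAlg p σ, T (refVector p) = x ∧ (star T) (refVector p) ∈ truncated p n := by
  induction hx using Submodule.span_induction with
  | mem x hx =>
    obtain ⟨a, ha, rfl⟩ := hx
    obtain ⟨b, T, hT, h⟩ := exists_isSideMul_refVector hm σ ha
    exact ⟨T, hT.mem_sideAlg, h⟩
  | zero =>
    refine ⟨0, fun S _ => by rw [mul_zero, zero_mul], rfl, ?_⟩
    rw [star_zero]
    exact Submodule.zero_mem _
  | add x y _ _ hx hy =>
    obtain ⟨S, hS, rfl, hS'⟩ := hx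
    obtain ⟨T, hT, rfl, hT'⟩ := hy
    refine ⟨S + T, add_mem_sideAlg hS hT, rfl, ?_⟩
    rw [star_add]
    exact Submodule.add_mem _ hS' hT'
  | smul c x _ hx =>
    obtain ⟨S, hS, rfl, hS'⟩ := hx
    refine ⟨c • S, smul_mem_sideAlg c hS, rfl, ?_⟩
    rw [star_smul]
    exact Submodule.smul_mem _ _ hS'

lemma tomitaPair_side (hm : IsUnit (refMatrix p)) :
    TomitaPair (sideAlg p false) (sideAlg p true) (refVector p) (truncated p) where
  star_left _ := star_mem_sideAlg
  star_right _ := star_mem_sideAlg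
  comm _ ha _ hb := sideAlg_comm ha hb
  mono := truncated_mono
  finite := finiteDimensional_truncated
  dense := dense_span_tensor.mono span_tensor_le_iSup_truncated
  lift_left := lift_truncated hm false
  lift_right := lift_truncated hm true

lemma tomitaPair (hm : IsUnit (refMatrix p)) :
    TomitaPair (leftAlg p) (rightAlg p) (refVector p) (truncated p) := by
  rw [leftAlg_eq, rightAlg_eq]
  exact tomitaPair_side hm

/-- Invertibility of $m$ identifies the vectors $a\xi$ with all elementary tensors, so the abstract
core is the one required. -/
lemma localVectors_eq (hm : IsUnit (refMatrix p)) : localVectors p = ⨆ n, truncated p n := by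
  refine le_antisymm (Submodule.span_le.2 ?_) (iSup_le fun n => Submodule.span_le.2 ?_)
  · rintro _ ⟨a, A, hA, rfl⟩
    exact span_tensor_le_iSup_truncated (Submodule.subset_span ⟨_, (hA _).symm⟩)
  · rintro _ ⟨a, ha, rfl⟩
    obtain ⟨b, T, hT, h, -⟩ := exists_isSideMul_refVector hm false ha
    exact Submodule.subset_span ⟨b, T, hT, h.symm⟩

/-- By cyclicity of the trace, $\operatorname{Tr}(m^*E_{ji}m)=(mm^*)_{ij}$. This links the Okounkov
operators to the modular operator. -/
lemma okMatrix_false : okMatrix p false = refMatrix p * (refMatrix p).conjTranspose := by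
  ext i j
  rw [okMatrix, Matrix.of_apply, side_false, hs, Matrix.trace_mul_comm, Matrix.mul_assoc,
    Matrix.trace_single_mul, one_smul]

/-- The matrix identity behind `Δ(aξ) = P a P⁻¹ ξ`. -/
lemma refMatrix_conj (hm : IsUnit (refMatrix p)) (a : M2) :
    refMatrix p * ((refMatrix p)⁻¹ * a.conjTranspose * refMatrix p).conjTranspose
      = okMatrix p false * a * (okMatrix p false)⁻¹ * refMatrix p := by
  have hd := (Matrix.isUnit_iff_isUnit_det _).1 hm
  rw [okMatrix_false, Matrix.mul_inv_rev, Matrix.conjTranspose_mul, Matrix.conjTranspose_mul,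
    Matrix.conjTranspose_conjTranspose, Matrix.conjTranspose_nonsing_inv]
  simp only [Matrix.mul_assoc]
  rw [Matrix.nonsing_inv_mul _ hd, Matrix.mul_one]

/-! ### The modular operator in terms of the Okounkov operators. -/

lemma okounkovProd_eq {J : L2X p ≃ₗᵢ[ℂ] TensorH p} {O : ℕ → (L2X p →L[ℂ] L2X p)} {Q : M2}
    (hO : ∀ k, pushOp J (O k) = siteOp k (side false Q)) (n : ℕ) :
    okounkovProd J O n = prodOp false (fun _ => Q) n := by
  induction n with
  | zero => rfl
  | succ n ih =>
    have h : okounkovProd J O (n + 1) = okounkovProd J O n * pushOp J (O n) := by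
      simp [okounkovProd, List.range_succ]
    rw [h, ih, hO]
    rfl

/-- The element `e ⊗ ⋯ ⊗ e ⊗ 1 ⊗ 1 ⊗ ⋯` with `n` factors `e`. -/
def powElem (n : ℕ) (e : M2) : LocalElem :=
  ⟨fun i => if i < n then e else 1, eventually_atTop.2 ⟨n, fun _ hi => if_neg (not_lt.2 hi)⟩⟩

lemma isSideMul_powElem (σ : Bool) (n : ℕ) (e : M2) :
    IsSideMul (p := p) σ (powElem n e) (prodOp σ (fun _ => e) n) :=
  isSideMul_prodOp σ _ n _ (fun _ hi => if_pos hi) fun _ hi => if_neg (not_lt.2 hi)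

lemma inverse_prodOp (σ : Bool) (n : ℕ) {e : M2} (he : IsUnit e) :
    Ring.inverse (prodOp (p := p) σ (fun _ => e) n) = prodOp σ (fun _ => e⁻¹) n := by
  have hd := (Matrix.isUnit_iff_isUnit_det _).1 he
  have h : ∀ f g : M2, f * g = 1 → prodOp (p := p) σ (fun _ => f) n * prodOp σ (fun _ => g) n = 1 :=
    fun f g hfg => by
      refine (isSideMul_mul (d := powElem n 1) (isSideMul_powElem σ n f) (isSideMul_powElem σ n g)
        fun i => ?_).unique (isSideMul_one σ fun i => by simp [powElem])
      by_cases hi : i < n <;> simp [powElem, hi, hfg]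
  exact Ring.inverse_unit ⟨_, _, h _ _ (Matrix.mul_nonsing_inv _ hd),
    h _ _ (Matrix.nonsing_inv_mul _ hd)⟩

/-- The intermediate vector $S(a\xi)=a^*\xi$ equals $B\xi$ for a right multiplication $B$, so that
$F$ sends it to $B^*\xi$, which `refMatrix_conj` evaluates site by site. -/
lemma conj_mem_graph (hm : IsUnit (refMatrix p)) {n : ℕ} {a : LocalElem}
    {A : TensorH p →L[ℂ] TensorH p} (ha : ∀ i, n ≤ i → a.toFun i = 1) (hA : IsLeftMul a A) :
    (A (refVector p), (prodOp (p := p) false (fun _ => okMatrix p false) n * A *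
      prodOp (p := p) false (fun _ => (okMatrix p false)⁻¹) n : TensorH p →L[ℂ] TensorH p)
        (refVector p))
        ∈ (tomitaPair hm).modularOp.graph := by
  have hd := (Matrix.isUnit_iff_isUnit_det _).1 hm
  rw [TomitaPair.graph_modularOp]
  -- $B$ is to be right multiplication by $m^{-1}a_i^*m$; the transpose undoes the one built into
  -- `side true`.
  let c : LocalElem :=
    a.map (fun x => ((refMatrix p)⁻¹ * x.conjTranspose * refMatrix p).transpose) (by
      rw [Matrix.conjTranspose_one, Matrix.mul_one, Matrix.nonsing_inv_mul _ hd,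
        Matrix.transpose_one])
  obtain ⟨B, hB⟩ := exists_isSideMul (p := p) true c
  refine ⟨(star A) (refVector p), subset_closure ⟨A, IsSideMul.mem_sideAlg (σ := false) hA, rfl⟩,
    subset_closure ⟨B, ?_, Prod.ext ?_ ?_⟩⟩
  · rw [rightAlg_eq]
    exact hB.mem_sideAlg
  · refine (IsSideMul.star (σ := false) hA _).trans
      (hB.apply_refVector fun i => ?_).symm
    change refMatrix p * (((refMatrix p)⁻¹ * (a.toFun i).conjTranspose
      * refMatrix p).transpose).transpose = (a.toFun i).conjTranspose * refMatrix p
    rw [Matrix.transpose_transpose, Matrix.mul_assoc, ← Matrix.mul_assoc,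
      Matrix.mul_nonsing_inv _ hd, Matrix.one_mul]
  · have h1 := isSideMul_mul (d := ⟨fun i => (powElem n (okMatrix p false)).toFun i * a.toFun i *
        (powElem n (okMatrix p false)⁻¹).toFun i, by
        filter_upwards [eventually_ge_atTop n] with i hi
        simp [powElem, not_lt.2 hi, ha i hi]⟩)
      (isSideMul_mul (p := p) (σ := false)
        (d := ⟨fun i => (powElem n (okMatrix p false)).toFun i * a.toFun i, by
          filter_upwards [eventually_ge_atTop n] with i hi
          simp [powElem, not_lt.2 hi, ha i hi]⟩)
        (isSideMul_powElem false n (okMatrix p false)) hA fun i => rfl)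
      (isSideMul_powElem false n (okMatrix p false)⁻¹) fun i => rfl
    refine Eq.trans (h1 _) (hB.star.apply_refVector fun i => ?_).symm
    change refMatrix p * ((((refMatrix p)⁻¹ * (a.toFun i).conjTranspose
      * refMatrix p).transpose).conjTranspose).transpose
      = (powElem n (okMatrix p false)).toFun i * a.toFun i *
        (powElem n (okMatrix p false)⁻¹).toFun i * refMatrix p
    have h2 : ∀ x : M2, (x.transpose.conjTranspose).transpose = x.conjTranspose := fun x => rfl
    rw [h2]
    by_cases hi : i < n
    · simp only [powElem, hi, if_true]
      exact refMatrix_conj hm _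
    · simp only [powElem, hi, if_false]
      rw [ha i (not_lt.1 hi), Matrix.conjTranspose_one, Matrix.mul_one,
        Matrix.nonsing_inv_mul _ hd, Matrix.conjTranspose_one, Matrix.mul_one, Matrix.one_mul,
        Matrix.one_mul, Matrix.one_mul]

lemma isOkounkov (hp : ∀ z, p z ≠ 0)
    {π : Wreath × Wreath →* unitary (L2X p →L[ℂ] L2X p)} (hπ : IsRepMu p π)
    {J : L2X p ≃ₗᵢ[ℂ] TensorH p} (hJ : IsTensorId p J) (k : ℕ) :
    IsOkounkov π k (J.conjStarAlgEquiv.symm (siteOp k (side false (okMatrix p false)))) := by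
  intro ζ
  have h := (J.symm.continuous.tendsto _).comp
    (tendsto_average_transp hp hπ hJ false k (J ζ))
  refine h.congr fun n => ?_
  simp only [Function.comp_apply, map_smul, map_sum,
    LinearIsometryEquiv.conjStarAlgEquiv_apply_apply, LinearIsometryEquiv.symm_apply_apply]
  rfl

end

theorem proposition4 (p : PMF Site) (hp : ∀ z, p z ≠ 0) :
    -- the objects exist
    (∃ π : Wreath × Wreath →* unitary (L2X p →L[ℂ] L2X p), IsRepMu p π) ∧
    (∃ J : L2X p ≃ₗᵢ[ℂ] TensorH p, IsTensorId p J) ∧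
    (∀ b : LocalElem, (∃ T : TensorH p →L[ℂ] TensorH p, IsLeftMul b T) ∧
      ∃ T : TensorH p →L[ℂ] TensorH p, IsRightMul b T) ∧
    ∀ (π : Wreath × Wreath →* unitary (L2X p →L[ℂ] L2X p)) (J : L2X p ≃ₗᵢ[ℂ] TensorH p),
      IsRepMu p π → IsTensorId p J →
      -- the generated algebras
      doubleCommutant (rep0 π) = pullOp J '' leftAlg p ∧
      doubleCommutant (rep1 π) = pullOp J '' rightAlg p ∧
      -- the modular operator
      ((Matrix.of fun k l : Fin 2 => (p (k, l)).toReal).det ≠ 0 →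
        ∃ (O : ℕ → (L2X p →L[ℂ] L2X p)) (Δ : TensorH p →ₗ.[ℂ] TensorH p),
          (∀ k, IsOkounkov π k (O k) ∧ IsUnit (O k)) ∧
          IsModularOperator (leftAlg p) (rightAlg p) (refVector p) Δ ∧
          (∀ (n : ℕ) (a : LocalElem) (A : TensorH p →L[ℂ] TensorH p),
            (∀ i, n ≤ i → a.toFun i = 1) → IsLeftMul a A →
            (A (refVector p),
              (okounkovProd J O n * A * Ring.inverse (okounkovProd J O n)) (refVector p))
                ∈ Δ.graph) ∧
          Δ.HasCore (localVectors p)) := by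
  refine ⟨exists_isRepMu hp, exists_isTensorId hp,
    fun b => ⟨exists_isSideMul false b, 
      (exists_isSideMul true _).imp fun T => (isRightMul_iff b T).2⟩, fun π J hπ hJ =>
    ⟨doubleCommutant_rep hp hπ hJ false, ?_, fun hdet => ?_⟩⟩
  · rw [rightAlg_eq]
    exact doubleCommutant_rep hp hπ hJ true
  have hm := isUnit_refMatrix hdet
  have hQ : IsUnit (okMatrix p false) := by
    rw [okMatrix_false]
    refine hm.mul ?_
    rw [← Matrix.star_eq_conjTranspose]
    exact hm.star
  refine ⟨fun k => J.conjStarAlgEquiv.symm (siteOp k (side false (okMatrix p false))),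
    (tomitaPair hm).modularOp, fun k => ⟨isOkounkov hp hπ hJ k, ?_⟩,
    (tomitaPair hm).isModularOperator, fun n a A ha hA => ?_, ?_⟩
  · exact ((hQ.map (side false)).map (siteOp (p := p) k)).map J.conjStarAlgEquiv.symm
  · rw [okounkovProd_eq (Q := okMatrix p false)
      (fun k => J.conjStarAlgEquiv.apply_symm_apply _), inverse_prodOp false n hQ]
    exact conj_mem_graph hm ha hA
  · rw [localVectors_eq hm]
    exact (tomitaPair hm).hasCore
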